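/- **Setting.** Let $K\ge 2$, let $\mathcal A=\{(i,j):1\le i<j\le K\}$ and let $\Delta$ be the probability simplex on $\mathcal A$. A parameter is $\theta=(\theta_2,\dots,\theta_K)\in\mathbb R^{K-1}$, with $\theta_1:=0$. A rank $r(\theta)$ of $\theta$ is a permutation $(r_1,\dots,r_K)$ of $\{1,\dots,K\}$ with $\theta_{r_1}\ge\dots\ge\theta_{r_K}$; in all conditions below $r(\tilde\theta)\ne r(\theta)$ means that some rank of $\tilde\theta$ differs from some rank of $\theta$ (the rank is unique when there are no ties). Let $\rho$ be a probability density on $\mathbb R^{K-1}$ and $W=\overline{\{\rho>0\}}$. For $\theta\in W$ and $a\in\mathcal A$ let $f_\theta^a$ be a probability mass function on $\{0,1\}$, and put $D^a(\theta\|\tilde\theta)=\sum_{x}f^a_\theta(x)\log\frac{f^a_\theta(x)}{f^a_{\tilde\theta}(x)}$, $$D(\theta)=\max_{\lambda\in\Delta}\ \min_{\tilde\theta\in W,\ r(\tilde\theta)\ne r(\theta)}\ \sum_{a\in\mathcal A}\lambda^aD^a(\theta\|\tilde\theta),$$ let $\lambda^*(\theta)$ be a maximizer, and for $c>0$ put $t_c(\theta)=|\log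 c|/D(\theta)$ and $\mathbb E\,t_c(\Theta)=\int_W t_c(\theta)\rho(\theta)\,d\theta$. **Sequential experiment.** $\Theta$ has density $\rho$. For each $c>0$ a selection rule is given: $\lambda_n\in\Delta$ is a function of $a_1,X_1,\dots,a_{n-1},X_{n-1}$ and, conditionally on $\Theta$ and these variables, the pair $a_n$ is drawn from $\lambda_n$ and then $X_n\in\{0,1\}$ from $f_\Theta^{a_n}$. Let $l_n(\theta)=\sum_{k=1}^n\log f_\theta^{a_k}(X_k)$, let $\hat\theta^{(n)}$ be a maximizer of $l_n$ over $W$, let $W_{i,j}=\{\theta\in W:\theta_i\ge\theta_j\}$ and $G_n^{i,j}=\bigl|\sup_{W_{i,j}}l_n-\sup_{W_{j,i}}l_n\bigr|$. Fix $\alpha\in(0,1)$, let $h(c)=|\log c|(1+|\log c|^{-\alpha})$, and $$T_1=\inf\Bigl\{n>1:\sum_{(i,j)\in\mathcal A}e^{-G_n^{i,j}}\le e^{-h(c)}\Bigr\},\qquad T_2=\inf\Bigl\{n>1:\min_{(i,j)\in\mathcal A}G_n^{i,j}\ge h(c)\Bigr\}.$$ **Assumptions.** 1. $W$ is compact and,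 for every permutation $\sigma$, the set of all $\theta\in W$ with rank $\sigma$ has nonempty interior. 2. There is $\delta_b>0$ with $m(B(\theta,s)\cap W)\ge\min\{\delta_bs^{K-1},1\}$ for all $\theta\in W$, $s>0$ ($m$ is Lebesgue measure). 3. $\theta\mapsto\log f_\theta^a(x)$ is (finite and) continuously differentiable on a neighbourhood of $W$ for all $a,x$, and $\sup_{\theta\in W,a,x}\|\nabla_\theta\log f^a_\theta(x)\|<\infty$. 4. $\inf_{\theta,\tilde\theta\in W,\ r(\tilde\theta)\ne r(\theta)}\ \max_{a}D^a(\theta\|\tilde\theta)>0$ (in particular, no $\theta\in W$ has $\theta_i=\theta_j$ for some $i\ne j$). 5. $\inf_{W^\circ}\rho>0$ and $\sup_W\rho<\infty$. 6. (Exploration) There is $\delta_0>0$ such that for all sufficiently small $c$, almost surely, $\min_{n,a}\lambda_n^a\ge|\log c|^{-\frac12+\delta_0}$. 7. (Identifiability) For all $\theta\ne\theta'$ in $W$ there is $a\in\mathcal A$ with $f^a_\theta\ne f^a_{\theta'}$. 8. (Asymptotic adoption of the max–min optimal design) $\lim_{c\to0}\ \operatorname{ess\,sup}\ \sup_{n\ge2}\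 \sum_{a\in\mathcal A}\bigl|\lambda^{*,a}(\hat\theta^{(n-1)})-\lambda_n^a\bigr|=0$. **Theorem.** Under these assumptions $$\limsup_{c\to0}\frac{\mathbb E\,T_i}{\mathbb E\,t_c(\Theta)}\le1\qquad(i=1,2).$$ -/

import Mathlib

open MeasureTheory Filter Topology
open scoped ENNReal

noncomputable section

namespace SeqRank

/-- The unknown parameter `(θ₂, …, θ_K)` for `K = d + 1` items. -/
abbrev Param (d : ℕ) : Type := EuclideanSpace ℝ (Fin d)

/-- The scores of all `K = d + 1` items; the score of the first item is fixed to be `0`. -/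
def score {d : ℕ} (θ : Param d) (i : Fin (d + 1)) : ℝ :=
  (Fin.cons 0 (fun j : Fin d => θ j) : Fin (d + 1) → ℝ) i

/-- The set `𝒜` of pairs `(i, j)` with `i < j`. -/
abbrev Pair (d : ℕ) : Type := {p : Fin (d + 1) × Fin (d + 1) // p.1 < p.2}

/-- One comparison: the selected pair, and the outcome in `{0, 1}`. -/
abbrev Obs (d : ℕ) : Type := Pair d × Fin 2

/-- A record of `n` comparisons. -/
abbrev Hist (d n : ℕ) : Type := Fin n → Obs d

/-- `σ = (r₁, …, r_K)` is a rank of `θ`, that is `θ_{r₁} ≥ θ_{r₂} ≥ … ≥ θ_{r_K}`.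
It is unique precisely when the scores have no ties. -/
def IsRank {d : ℕ} (σ : Equiv.Perm (Fin (d + 1))) (θ : Param d) : Prop :=
  Antitone fun k => score θ (σ k)

/-- `r(θ') ≠ r(θ)`. -/
def RankNe {d : ℕ} (θ θ' : Param d) : Prop :=
  ∃ σ σ' : Equiv.Perm (Fin (d + 1)), IsRank σ θ ∧ IsRank σ' θ' ∧ σ ≠ σ'

/-! ### Prior -/

/-- `ρ` is a probability density with respect to Lebesgue measure. -/
structure IsPriorDensity {d : ℕ} (ρ : Param d → ℝ) : Prop where
  measurable : Measurable ρ
  nonneg : ∀ θ, 0 ≤ ρ θ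
  lintegral_eq_one : ∫⁻ θ, ENNReal.ofReal (ρ θ) = 1

/-- The support `W` of the prior. -/
def priorSupport {d : ℕ} (ρ : Param d → ℝ) : Set (Param d) := closure {θ | 0 < ρ θ}

/-- `W_{i,j} = {θ ∈ W : θ_i ≥ θ_j}`. -/
def halfSupport {d : ℕ} (W : Set (Param d)) (i j : Fin (d + 1)) : Set (Param d) :=
  {θ | score θ j ≤ score θ i} ∩ W

/-! ### Comparison model, likelihood and Kullback-Leibler divergence -/

/-- `f θ a` is a probability mass function on `{0, 1}`, for all `θ ∈ W` and all pairs `a`. -/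
def IsComparisonModel {d : ℕ} (f : Param d → Pair d → Fin 2 → ℝ) (W : Set (Param d)) : Prop :=
  ∀ θ ∈ W, ∀ a, (∀ x, 0 ≤ f θ a x) ∧ ∑ x, f θ a x = 1

/-- The log-likelihood `l_n(θ)`. -/
def logLik {d : ℕ} (f : Param d → Pair d → Fin 2 → ℝ) {n : ℕ} (h : Hist d n) (θ : Param d) : ℝ :=
  ∑ k, Real.log (f θ (h k).1 (h k).2)

/-- `mle n h` is a maximum likelihood estimator over `W` based on the record `h` of the first
`n` comparisons (an arbitrary choice of the maximizer). -/
def IsMLE {d : ℕ} (f : Param d → Pair d → Fin 2 → ℝ) (W : Set (Param d))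
    (mle : (n : ℕ) → Hist d n → Param d) : Prop :=
  ∀ n h, mle n h ∈ W ∧ IsMaxOn (logLik f h) W (mle n h)

/-- `D^a(θ ‖ θ')`. -/
def klPair {d : ℕ} (f : Param d → Pair d → Fin 2 → ℝ) (a : Pair d) (θ θ' : Param d) : ℝ :=
  ∑ x, f θ a x * Real.log (f θ a x / f θ' a x)

/-- `min_{θ' ∈ W, r(θ') ≠ r(θ)} ∑_a w^a D^a(θ ‖ θ')`. -/
def designValue {d : ℕ} (f : Param d → Pair d → Fin 2 → ℝ) (W : Set (Param d))
    (θ : Param d) (w : Pair d → ℝ) : ℝ :=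
  sInf ((fun θ' => ∑ a, w a * klPair f a θ θ') '' {θ' | θ' ∈ W ∧ RankNe θ θ'})

/-- `D(θ)`, the max-min value; the maximum is over the probability simplex `Δ` on the pairs. -/
def maxMin {d : ℕ} (f : Param d → Pair d → Fin 2 → ℝ) (W : Set (Param d)) (θ : Param d) : ℝ :=
  sSup (designValue f W θ '' stdSimplex ℝ (Pair d))

/-- `wStar θ` is a max-min optimal design `λ*(θ)` for every `θ ∈ W`
(an arbitrary choice of the maximizer). -/
def IsOptimalDesign {d : ℕ} (f : Param d → Pair d → Fin 2 → ℝ) (W : Set (Param d))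
    (wStar : Param d → Pair d → ℝ) : Prop :=
  ∀ θ ∈ W, wStar θ ∈ stdSimplex ℝ (Pair d) ∧
    IsMaxOn (designValue f W θ) (stdSimplex ℝ (Pair d)) (wStar θ)

/-- `t_c(θ) = |log c| / D(θ)`. -/
def tc {d : ℕ} (f : Param d → Pair d → Fin 2 → ℝ) (W : Set (Param d)) (c : ℝ) (θ : Param d) : ℝ :=
  |Real.log c| / maxMin f W θ

/-- `𝔼 t_c(Θ) = ∫_W t_c(θ) ρ(θ) dθ`. -/
def expectedTc {d : ℕ} (f : Param d → Pair d → Fin 2 → ℝ) (ρ : Param d → ℝ) (c : ℝ) : ℝ :=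
  ∫ θ in priorSupport ρ, tc f (priorSupport ρ) c θ * ρ θ

/-! ### Regularity assumptions -/

/-- The support is compact, and each rank occurs in it with nonempty interior. -/
def CompactSupport {d : ℕ} (W : Set (Param d)) : Prop :=
  IsCompact W ∧ ∀ σ : Equiv.Perm (Fin (d + 1)), (interior ({θ | IsRank σ θ} ∩ W)).Nonempty

/-- The support is not singular: `m(B(θ, s) ∩ W) ≥ min {δ s^(K-1), 1}`. -/
def RegularSupport {d : ℕ} (W : Set (Param d)) : Prop :=
  ∃ δ > (0 : ℝ), ∀ θ ∈ W, ∀ s > (0 : ℝ),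
    ENNReal.ofReal (min (δ * s ^ d) 1) ≤ volume (Metric.ball θ s ∩ W)

/-- `θ ↦ log f_θ^a(x)` is (well defined and) continuously differentiable near `W`, with
uniformly bounded gradient on `W`. -/
def SmoothLikelihood {d : ℕ} (f : Param d → Pair d → Fin 2 → ℝ) (W : Set (Param d)) : Prop :=
  (∃ U : Set (Param d), IsOpen U ∧ W ⊆ U ∧ ∀ a x,
    (∀ θ ∈ U, 0 < f θ a x) ∧ ContDiffOn ℝ 1 (fun θ => Real.log (f θ a x)) U) ∧
  ∃ C : ℝ, ∀ θ ∈ W, ∀ a x, ‖gradient (fun θ' => Real.log (f θ' a x)) θ‖ ≤ C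

/-- Different ranks are separated: `max_a D^a(θ ‖ θ')` is bounded away from `0` over all
`θ, θ' ∈ W` with `r(θ') ≠ r(θ)`. In particular there is no tie in `W`. -/
def Separated {d : ℕ} (f : Param d → Pair d → Fin 2 → ℝ) (W : Set (Param d)) : Prop :=
  ∃ η > (0 : ℝ), ∀ θ ∈ W, ∀ θ' ∈ W, RankNe θ θ' → ∃ a, η ≤ klPair f a θ θ'

/-- The prior density is bounded above on `W` and bounded away from `0` in its interior. -/
def PriorBounded {d : ℕ} (ρ : Param d → ℝ) : Prop :=
  (∃ m > (0 : ℝ), ∀ θ ∈ interior (priorSupport ρ), m ≤ ρ θ) ∧ ∃ M : ℝ, ∀ θ ∈ priorSupport ρ, ρ θ ≤ M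

/-- Different parameters in `W` give different outcome distributions for some pair. -/
def Identifiable {d : ℕ} (f : Param d → Pair d → Fin 2 → ℝ) (W : Set (Param d)) : Prop :=
  ∀ θ ∈ W, ∀ θ' ∈ W, θ ≠ θ' → ∃ a, f θ a ≠ f θ' a

/-! ### Sequential experiments -/

/-- An adaptive randomized selection rule: `rule n h` is the distribution `λ_{n+1}` of the pair
selected for comparison `n + 1`, given the record `h` of the first `n` comparisons. -/
abbrev Rule (d : ℕ) : Type := (n : ℕ) → Hist d n → Pair d → ℝ

/-- The values of a selection rule are probability vectors. -/
def IsRule {d : ℕ} (rule : Rule d) : Prop := ∀ n h, rule n h ∈ stdSimplex ℝ (Pair d)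

/-- The record of the first `n` comparisons; `Y k` is comparison number `k + 1`. -/
def history {d : ℕ} {Ω : Type*} (Y : ℕ → Ω → Obs d) (n : ℕ) (ω : Ω) : Hist d n :=
  fun k => Y k ω

/-- The joint law of the parameter and the comparisons under a selection rule: `Θ` has density
`ρ`, and given `Θ` and the first `n` comparisons, the next pair is drawn from the selection rule
and its outcome is drawn from `f_Θ` for this pair. -/
structure IsExperiment {d : ℕ} (f : Param d → Pair d → Fin 2 → ℝ) (ρ : Param d → ℝ)
    (rule : Rule d) {Ω : Type*} [MeasurableSpace Ω] (P : Measure Ω)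
    (Θ : Ω → Param d) (Y : ℕ → Ω → Obs d) : Prop where
  measurable_param : Measurable Θ
  measurable_obs : ∀ n, Measurable (Y n)
  law_param : P.map Θ = volume.withDensity fun θ => ENNReal.ofReal (ρ θ)
  law_obs : ∀ (n : ℕ) (h : Hist d n) (a : Pair d) (x : Fin 2) (B : Set (Param d)),
    MeasurableSet B →
    P {ω | Θ ω ∈ B ∧ history Y n ω = h ∧ Y n ω = (a, x)} =
      ∫⁻ ω in {ω | Θ ω ∈ B ∧ history Y n ω = h}, ENNReal.ofReal (rule n h a * f (Θ ω) a x) ∂P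

/-- `h(c) = |log c| (1 + |log c|^(-α))`. -/
def threshold (α c : ℝ) : ℝ := |Real.log c| * (1 + |Real.log c| ^ (-α))

/-- `|sup_{W_{i,j}} l_n - sup_{W_{j,i}} l_n|` for the pair `p = (i, j)`. -/
def glr {d : ℕ} (f : Param d → Pair d → Fin 2 → ℝ) (W : Set (Param d)) {n : ℕ} (h : Hist d n)
    (p : Pair d) : ℝ :=
  |sSup (logLik f h '' halfSupport W p.1.1 p.1.2) - sSup (logLik f h '' halfSupport W p.1.2 p.1.1)|

/-- The stopping time `T₁`, with value `∞` if the criterion is never met. -/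
def stopTime₁ {d : ℕ} (f : Param d → Pair d → Fin 2 → ℝ) (W : Set (Param d)) (α c : ℝ)
    {Ω : Type*} (Y : ℕ → Ω → Obs d) (ω : Ω) : ℕ∞ :=
  ⨅ n ∈ {n : ℕ | 1 < n ∧
    ∑ p, Real.exp (-glr f W (history Y n ω) p) ≤ Real.exp (-threshold α c)}, (n : ℕ∞)

/-- The stopping time `T₂`, with value `∞` if the criterion is never met. -/
def stopTime₂ {d : ℕ} (f : Param d → Pair d → Fin 2 → ℝ) (W : Set (Param d)) (α c : ℝ)
    {Ω : Type*} (Y : ℕ → Ω → Obs d) (ω : Ω) : ℕ∞ :=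
  ⨅ n ∈ {n : ℕ | 1 < n ∧ ∀ p, threshold α c ≤ glr f W (history Y n ω) p}, (n : ℕ∞)

/-- `𝔼 T`, possibly infinite. -/
def expectedTime {Ω : Type*} [MeasurableSpace Ω] (P : Measure Ω) (T : Ω → ℕ∞) : ℝ≥0∞ :=
  ∫⁻ ω, (T ω : ℝ≥0∞) ∂P

/-- For some constant `δ₀ > 0` and all small `c`, almost surely every pair is always selected with
probability at least `|log c|^(-1/2 + δ₀)`. -/
def Explores {d : ℕ} (rule : ℝ → Rule d) {Ω : ℝ → Type*} [∀ c, MeasurableSpace (Ω c)]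
    (P : ∀ c, Measure (Ω c)) (Y : ∀ c, ℕ → Ω c → Obs d) : Prop :=
  ∃ δ₀ > (0 : ℝ), ∀ᶠ c in 𝓝[>] (0 : ℝ), ∀ᵐ ω ∂(P c), ∀ n a,
    |Real.log c| ^ (-(1 / 2 : ℝ) + δ₀) ≤ rule c n (history (Y c) n ω) a

/-- `sup_n ∑_a |λ*(θ̂^(n-1))^a - λ_n^a| → 0` as `c → 0`, uniformly up to a null set. The supremum
is over the comparisons `2, 3, …`, where the estimator is based on at least one observation. -/
def AdoptsOptimal {d : ℕ} (wStar : Param d → Pair d → ℝ) (mle : (n : ℕ) → Hist d n → Param d)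
    (rule : ℝ → Rule d) {Ω : ℝ → Type*} [∀ c, MeasurableSpace (Ω c)]
    (P : ∀ c, Measure (Ω c)) (Y : ∀ c, ℕ → Ω c → Obs d) : Prop :=
  ∀ ε > (0 : ℝ), ∀ᶠ c in 𝓝[>] (0 : ℝ), ∀ᵐ ω ∂(P c), ∀ n ≥ 1,
    ∑ a, |wStar (mle n (history (Y c) n ω)) a - rule c n (history (Y c) n ω) a| ≤ ε

end SeqRank

end

open SeqRank

/-!
The number of pairs and outcomes is finite, so the log-likelihood depends on the record only through
the counts of the observations `y = (a, x)`. Centring each count by its compensator gives a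
martingale, `deviation`, and `IsRegularModel.logLik_sub_logLik` writes the log-likelihood ratio
`l_n(θ) - l_n(τ)` as the accumulated information `∑_k ∑_a λ_k^a D^a(θ ‖ τ)` plus a linear function
of the deviations with uniformly bounded coefficients. Hence control of finitely many martingales
controls the ratio uniformly in `τ`, and no covering of `W` is needed. The exponential moments of the
deviations (`IsExperiment.lintegral_exp_deviation_le`) show that the expected number of times `n` at
which some deviation exceeds `t n` is at most of order `t ^ (-2)`
(`IsExperiment.lintegral_encard_deviationTimes_le`).

Let `L = |log c|` and let `p = L ^ (-1/2 + δ₀)` be the exploration rate. Outside the times at which a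
deviation exceeds a small multiple of `p n`, exploration and identifiability force the maximum
likelihood estimator to be close to the true parameter (`IsRegularModel.dist_mle_lt`); the expected
number of exceptional times is of order `p ^ (-2) = L ^ (1 - 2 δ₀)`, which is `o(L)`. At all other
times the adopted design is almost optimal at an estimate close to `Θ`. The design value is continuous
in the parameter, uniformly over designs, because ranks are locally constant on `W`; so this design
gains information at rate nearly `D(Θ)` against every alternative
(`IsRegularModel.exists_information_ge`).

Along a path, therefore, both criteria hold at the latest at time
`(1 + ε) ((h(c) + log |𝒜|) / D(Θ) + #exceptional times)`, up to a constant and the number of times at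
which a deviation exceeds a fixed multiple of `n` (`stopping_bound`). The expectation of this bound,
divided by `𝔼 t_c(Θ)`, which is `L` times a positive constant, tends to `1 + ε`.
-/

namespace SeqRank

variable {d : ℕ}

/-! ### Ranks -/

lemma exists_isRank (θ : Param d) : ∃ σ, IsRank σ θ := by
  refine ⟨Tuple.sort fun i => -score θ i, fun k l hkl => ?_⟩
  have := Tuple.monotone_sort (fun i => -score θ i) hkl
  simpa using this

lemma rankNe_self_of_tie {θ : Param d} {i j : Fin (d + 1)} (hij : i ≠ j)
    (h : score θ i = score θ j) : RankNe θ θ := by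
  obtain ⟨σ, hσ⟩ := exists_isRank θ
  have hs : ∀ k, score θ (Equiv.swap i j k) = score θ k := by
    intro k
    rcases eq_or_ne k i with rfl | hi
    · rw [Equiv.swap_apply_left, h]
    rcases eq_or_ne k j with rfl | hj
    · rw [Equiv.swap_apply_right, h]
    rw [Equiv.swap_apply_of_ne_of_ne hi hj]
  refine ⟨σ, σ.trans (Equiv.swap i j), hσ, ?_, fun he => ?_⟩
  · intro k l hkl
    simp only [Equiv.trans_apply, hs]
    exact hσ hkl
  · have := congrArg (fun τ : Equiv.Perm (Fin (d + 1)) => τ (σ.symm i)) he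
    simp [hij] at this

lemma isRank_of_not_rankNe {θ θ' : Param d} (h : ¬ RankNe θ θ') {σ : Equiv.Perm (Fin (d + 1))}
    (hσ : IsRank σ θ) : IsRank σ θ' := by
  obtain ⟨σ', hσ'⟩ := exists_isRank θ'
  by_cases he : σ = σ'
  · exact he ▸ hσ'
  · exact (h ⟨σ, σ', hσ, hσ', he⟩).elim

lemma RankNe.symm {θ θ' : Param d} (h : RankNe θ θ') : RankNe θ' θ := by
  obtain ⟨σ, σ', h1, h2, h3⟩ := h
  exact ⟨σ', σ, h2, h1, h3.symm⟩

/-- Parameters with the same rank have the same alternatives. -/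
lemma RankNe.of_not_rankNe {θ θ' τ : Param d} (h : ¬ RankNe θ θ') (hτ : RankNe θ τ) :
    RankNe θ' τ := by
  obtain ⟨σ, σ', h1, h2, h3⟩ := hτ
  exact ⟨σ, σ', isRank_of_not_rankNe h h1, h2, h3⟩

lemma rankNe_of_reversed {θ θ' : Param d} {i j : Fin (d + 1)} (h : score θ j < score θ i)
    (h' : score θ' i ≤ score θ' j) (hties : ¬ RankNe θ' θ') : RankNe θ θ' := by
  by_contra hne
  obtain ⟨σ, hσ⟩ := exists_isRank θ
  have hσ' := isRank_of_not_rankNe hne hσ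
  have hlt : σ.symm i ≤ σ.symm j := by
    by_contra! hc
    have := hσ hc.le
    simp only [Equiv.apply_symm_apply] at this
    linarith
  have h2 := hσ' hlt
  simp only [Equiv.apply_symm_apply] at h2
  exact hties (rankNe_self_of_tie (by rintro rfl; exact lt_irrefl _ h) (le_antisymm h' h2))

/-! ### Kullback-Leibler divergences on the support -/

/-- The part of the assumptions on the comparison model that the analysis of the likelihood uses:
on the compact support `W`, the outcome probabilities are positive and their logarithms are
continuous. -/
structure IsRegularModel (f : Param d → Pair d → Fin 2 → ℝ) (W : Set (Param d)) : Prop where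
  isCompact : IsCompact W
  model : IsComparisonModel f W
  pos : ∀ θ ∈ W, ∀ a x, 0 < f θ a x
  continuousOn_log : ∀ a x, ContinuousOn (fun θ => Real.log (f θ a x)) W

lemma IsRegularModel.of_smooth {f : Param d → Pair d → Fin 2 → ℝ} {W : Set (Param d)}
    (hW : IsCompact W) (hf : IsComparisonModel f W) (hs : SmoothLikelihood f W) :
    IsRegularModel f W := by
  obtain ⟨⟨U, -, hWU, hU⟩, -⟩ := hs
  exact ⟨hW, hf, fun θ hθ a x => (hU a x).1 θ (hWU hθ),
    fun a x => (hU a x).2.continuousOn.mono hWU⟩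

namespace IsRegularModel

variable {f : Param d → Pair d → Fin 2 → ℝ} {W : Set (Param d)}

lemma continuousOn (hr : IsRegularModel f W) (a : Pair d) (x : Fin 2) :
    ContinuousOn (fun θ => f θ a x) W :=
  (Real.continuous_exp.comp_continuousOn (hr.continuousOn_log a x)).congr
    fun θ hθ => (Real.exp_log (hr.pos θ hθ a x)).symm

lemma exists_log_bound (hr : IsRegularModel f W) :
    ∃ B > 0, ∀ θ ∈ W, ∀ a x, |Real.log (f θ a x)| ≤ B := by
  have h : ∀ y : Obs d, ∃ C, ∀ θ ∈ W, |Real.log (f θ y.1 y.2)| ≤ C := fun y => by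
    simpa using hr.isCompact.exists_bound_of_continuousOn (hr.continuousOn_log y.1 y.2)
  choose C hC using h
  refine ⟨1 + ∑ y, |C y|, by positivity, fun θ hθ a x => (hC (a, x) θ hθ).trans ?_⟩
  have := Finset.single_le_sum (f := fun y => |C y|) (fun y _ => abs_nonneg _)
    (Finset.mem_univ (a, x))
  have := le_abs_self (C (a, x))
  linarith

lemma klPair_eq (hr : IsRegularModel f W) {θ θ' : Param d} (hθ : θ ∈ W) (hθ' : θ' ∈ W)
    (a : Pair d) :
    klPair f a θ θ' = ∑ x, f θ a x * (Real.log (f θ a x) - Real.log (f θ' a x)) := by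
  refine Finset.sum_congr rfl fun x _ => ?_
  rw [Real.log_div (hr.pos θ hθ a x).ne' (hr.pos θ' hθ' a x).ne']

lemma klPair_self (hr : IsRegularModel f W) {θ : Param d} (hθ : θ ∈ W) (a : Pair d) :
    klPair f a θ θ = 0 := by
  simp [hr.klPair_eq hθ hθ]

/-- Each term of the divergence is at least `f_θ - f_θ'`, and these differences sum to `0`. -/
lemma klPair_nonneg (hr : IsRegularModel f W) {θ θ' : Param d} (hθ : θ ∈ W) (hθ' : θ' ∈ W)
    (a : Pair d) : 0 ≤ klPair f a θ θ' := by
  have h : ∀ x, f θ a x - f θ' a x ≤ f θ a x * Real.log (f θ a x / f θ' a x) := fun x => by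
    have h1 := hr.pos θ hθ a x
    have h2 := hr.pos θ' hθ' a x
    have h3 := Real.one_sub_inv_le_log_of_pos (div_pos h1 h2)
    have h4 := mul_le_mul_of_nonneg_left h3 h1.le
    have h5 : f θ a x * (1 - (f θ a x / f θ' a x)⁻¹) = f θ a x - f θ' a x := by
      field_simp
    linarith
  have hs := Finset.sum_le_sum (s := Finset.univ) fun x _ => h x
  rw [Finset.sum_sub_distrib, (hr.model θ hθ a).2, (hr.model θ' hθ' a).2, sub_self] at hs
  exact hs

lemma klPair_pos (hr : IsRegularModel f W) {θ θ' : Param d} (hθ : θ ∈ W) (hθ' : θ' ∈ W)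
    {a : Pair d} (hne : f θ a ≠ f θ' a) : 0 < klPair f a θ θ' := by
  have h : ∀ x, f θ a x - f θ' a x ≤ f θ a x * Real.log (f θ a x / f θ' a x) ∧
      (f θ a x ≠ f θ' a x →
        f θ a x - f θ' a x < f θ a x * Real.log (f θ a x / f θ' a x)) := fun x => by
    have h1 := hr.pos θ hθ a x
    have h2 := hr.pos θ' hθ' a x
    have h5 : f θ a x * (f θ' a x / f θ a x - 1) = f θ' a x - f θ a x := by
      field_simp
    have h6 : Real.log (f θ a x / f θ' a x) = -Real.log (f θ' a x / f θ a x) := by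
      rw [← Real.log_inv, inv_div]
    rw [h6]
    constructor
    · have h3 := Real.log_le_sub_one_of_pos (div_pos h2 h1)
      have h4 := mul_le_mul_of_nonneg_left h3 h1.le
      linarith
    · intro hx
      have h3 := Real.log_lt_sub_one_of_pos (div_pos h2 h1)
        (fun he => hx ((div_eq_one_iff_eq h1.ne').1 he).symm)
      have h4 := mul_lt_mul_of_pos_left h3 h1
      linarith
  obtain ⟨x, hx⟩ := Function.ne_iff.1 hne
  have hs := Finset.sum_lt_sum (s := Finset.univ) (fun x _ => (h x).1)
    ⟨x, Finset.mem_univ x, (h x).2 hx⟩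
  rw [Finset.sum_sub_distrib, (hr.model θ hθ a).2, (hr.model θ' hθ' a).2, sub_self] at hs
  exact hs

lemma klPair_le (hr : IsRegularModel f W) {B : ℝ}
    (hB : ∀ θ ∈ W, ∀ a x, |Real.log (f θ a x)| ≤ B) {θ θ' : Param d} (hθ : θ ∈ W) (hθ' : θ' ∈ W)
    (a : Pair d) : klPair f a θ θ' ≤ 2 * B := by
  rw [hr.klPair_eq hθ hθ']
  calc _ ≤ ∑ x, f θ a x * (2 * B) := Finset.sum_le_sum fun x _ => by
        have h1 := abs_le.1 (hB θ hθ a x)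
        have h2 := abs_le.1 (hB θ' hθ' a x)
        exact mul_le_mul_of_nonneg_left (by linarith) (hr.pos θ hθ a x).le
    _ = 2 * B := by rw [← Finset.sum_mul, (hr.model θ hθ a).2, one_mul]

lemma continuousOn_klPair (hr : IsRegularModel f W) (a : Pair d) :
    ContinuousOn (fun z : Param d × Param d => klPair f a z.1 z.2) (W ×ˢ W) := by
  have h1 : Set.MapsTo Prod.fst (W ×ˢ W) W := fun z hz => hz.1
  have h2 : Set.MapsTo Prod.snd (W ×ˢ W) W := fun z hz => hz.2
  refine ContinuousOn.congr (f := fun z => ∑ x, f z.1 a x *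
    (Real.log (f z.1 a x) - Real.log (f z.2 a x))) ?_ fun z hz => hr.klPair_eq hz.1 hz.2 a
  refine continuousOn_finsetSum _ fun x _ => ?_
  exact ((hr.continuousOn a x).comp continuousOn_fst h1).mul
    (((hr.continuousOn_log a x).comp continuousOn_fst h1).sub
      ((hr.continuousOn_log a x).comp continuousOn_snd h2))

lemma exists_klPair_close (hr : IsRegularModel f W) {ε : ℝ} (hε : 0 < ε) :
    ∃ r > 0, ∀ θ ∈ W, ∀ θ' ∈ W, dist θ θ' < r → ∀ τ ∈ W, ∀ a,
      |klPair f a θ τ - klPair f a θ' τ| < ε ∧ |klPair f a τ θ - klPair f a τ θ'| < ε := by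
  have h : ∀ a : Pair d, ∃ r > 0, ∀ z ∈ W ×ˢ W, ∀ z' ∈ W ×ˢ W, dist z z' < r →
      |klPair f a z.1 z.2 - klPair f a z'.1 z'.2| < ε := fun a =>
    Metric.uniformContinuousOn_iff.1
      ((hr.isCompact.prod hr.isCompact).uniformContinuousOn_of_continuous
        (hr.continuousOn_klPair a)) ε hε
  choose r hr0 hr1 using h
  obtain ⟨r', hr'0, hr'⟩ : ∃ r' > 0, ∀ a, r' ≤ r a := by
    rcases isEmpty_or_nonempty (Pair d) with he | hne
    · exact ⟨1, one_pos, fun a => he.elim a⟩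
    · obtain ⟨a, ha⟩ := Finite.exists_min r
      exact ⟨r a, hr0 a, ha⟩
  refine ⟨r', hr'0, fun θ hθ θ' hθ' hd τ hτ a => ⟨?_, ?_⟩⟩
  · refine hr1 a (θ, τ) ⟨hθ, hτ⟩ (θ', τ) ⟨hθ', hτ⟩ ?_
    simpa [Prod.dist_eq, hr0] using hd.trans_le (hr' a)
  · refine hr1 a (τ, θ) ⟨hτ, hθ⟩ (τ, θ') ⟨hτ, hθ'⟩ ?_
    simpa [Prod.dist_eq, hr0] using hd.trans_le (hr' a)

/-- Under identifiability, distinct parameters are uniformly distinguished by the total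
divergence once they are a fixed distance apart. -/
lemma exists_sum_klPair_ge (hr : IsRegularModel f W) (hid : Identifiable f W) {r : ℝ}
    (hr0 : 0 < r) :
    ∃ κ > 0, ∀ θ ∈ W, ∀ θ' ∈ W, r ≤ dist θ θ' → κ ≤ ∑ a, klPair f a θ θ' := by
  set S : Set (Param d × Param d) := (W ×ˢ W) ∩ {z | r ≤ dist z.1 z.2} with hS
  have hScomp : IsCompact S := (hr.isCompact.prod hr.isCompact).inter_right
    (isClosed_le continuous_const (continuous_fst.dist continuous_snd))
  have hcont : ContinuousOn (fun z : Param d × Param d => ∑ a, klPair f a z.1 z.2) S :=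
    continuousOn_finsetSum _ fun a _ => (hr.continuousOn_klPair a).mono Set.inter_subset_left
  rcases S.eq_empty_or_nonempty with he | hne
  · refine ⟨1, one_pos, fun θ hθ θ' hθ' hd => ?_⟩
    have : (θ, θ') ∈ S := ⟨⟨hθ, hθ'⟩, hd⟩
    simp [he] at this
  · obtain ⟨z, hz, hmin⟩ := hScomp.exists_isMinOn hne hcont
    refine ⟨_, ?_, fun θ hθ θ' hθ' hd => hmin (show (θ, θ') ∈ S from ⟨⟨hθ, hθ'⟩, hd⟩)⟩
    have hzne : z.1 ≠ z.2 := by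
      intro he
      have := hz.2
      simp only [Set.mem_ofPred_eq, he, dist_self] at this
      linarith
    obtain ⟨a, ha⟩ := hid _ hz.1.1 _ hz.1.2 hzne
    exact (hr.klPair_pos hz.1.1 hz.1.2 ha).trans_le (Finset.single_le_sum
      (f := fun a => klPair f a z.1 z.2) (fun a _ => hr.klPair_nonneg hz.1.1 hz.1.2 a)
      (Finset.mem_univ a))

lemma not_rankNe_self (hr : IsRegularModel f W) (hsep : Separated f W) {θ : Param d}
    (hθ : θ ∈ W) : ¬ RankNe θ θ := fun h => by
  obtain ⟨η, hη, hs⟩ := hsep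
  obtain ⟨a, ha⟩ := hs θ hθ θ hθ h
  rw [hr.klPair_self hθ] at ha
  linarith

/-- Nearby parameters have the same rank: otherwise their divergence, which is close to `0`,
would be bounded away from `0`. -/
lemma exists_not_rankNe (hr : IsRegularModel f W) (hsep : Separated f W) :
    ∃ r > 0, ∀ θ ∈ W, ∀ θ' ∈ W, dist θ θ' < r → ¬ RankNe θ θ' := by
  obtain ⟨η, hη, hs⟩ := hsep
  obtain ⟨r, hr0, h⟩ := hr.exists_klPair_close hη
  refine ⟨r, hr0, fun θ hθ θ' hθ' hd hne => ?_⟩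
  obtain ⟨a, ha⟩ := hs θ hθ θ' hθ' hne
  have := (h θ hθ θ' hθ' hd θ hθ a).2
  rw [hr.klPair_self hθ, zero_sub, abs_neg] at this
  exact absurd ha (not_le.2 ((le_abs_self _).trans_lt this))

/-! ### The max-min design problem -/

lemma sum_mul_klPair_nonneg (hr : IsRegularModel f W) {θ θ' : Param d} (hθ : θ ∈ W)
    (hθ' : θ' ∈ W) {w : Pair d → ℝ} (hw : w ∈ stdSimplex ℝ (Pair d)) :
    0 ≤ ∑ a, w a * klPair f a θ θ' :=
  Finset.sum_nonneg fun a _ => mul_nonneg (hw.1 a) (hr.klPair_nonneg hθ hθ' a)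

lemma designValue_le (hr : IsRegularModel f W) {θ θ' : Param d} (hθ : θ ∈ W) (hθ' : θ' ∈ W)
    (hne : RankNe θ θ') {w : Pair d → ℝ} (hw : w ∈ stdSimplex ℝ (Pair d)) :
    designValue f W θ w ≤ ∑ a, w a * klPair f a θ θ' := by
  refine csInf_le ⟨0, ?_⟩ ⟨θ', ⟨hθ', hne⟩, rfl⟩
  rintro _ ⟨τ, hτ, rfl⟩
  exact hr.sum_mul_klPair_nonneg hθ hτ.1 hw

lemma exists_designValue_close (hr : IsRegularModel f W) (hsep : Separated f W)
    (halt : ∀ θ ∈ W, ∃ θ' ∈ W, RankNe θ θ') {ε : ℝ} (hε : 0 < ε) :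
    ∃ r > 0, ∀ θ ∈ W, ∀ θ' ∈ W, dist θ θ' < r → ∀ w ∈ stdSimplex ℝ (Pair d),
      designValue f W θ w ≤ designValue f W θ' w + ε := by
  obtain ⟨r₁, hr₁, h₁⟩ := hr.exists_klPair_close hε
  obtain ⟨r₂, hr₂, h₂⟩ := hr.exists_not_rankNe hsep
  refine ⟨min r₁ r₂, lt_min hr₁ hr₂, fun θ hθ θ' hθ' hd w hw => ?_⟩
  rw [← sub_le_iff_le_add]
  obtain ⟨τ₀, hτ₀⟩ := halt θ' hθ'
  refine le_csInf ⟨_, τ₀, hτ₀, rfl⟩ ?_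
  rintro _ ⟨τ, ⟨hτ, hne⟩, rfl⟩
  have hne' : RankNe θ τ := hne.of_not_rankNe
    fun h => h₂ θ hθ θ' hθ' (hd.trans_le (min_le_right _ _)) h.symm
  have h3 := hr.designValue_le hθ hτ hne' hw
  have h4 : ∑ a, w a * klPair f a θ τ ≤ ∑ a, (w a * klPair f a θ' τ + w a * ε) :=
    Finset.sum_le_sum fun a _ => by
      have := (abs_lt.1 (h₁ θ hθ θ' hθ' (hd.trans_le (min_le_left _ _)) τ hτ a).1).2
      rw [← mul_add]
      exact mul_le_mul_of_nonneg_left (by linarith) (hw.1 a)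
  rw [Finset.sum_add_distrib, ← Finset.sum_mul, hw.2, one_mul] at h4
  simp only
  linarith

lemma maxMin_eq {wStar : Param d → Pair d → ℝ} (hw : IsOptimalDesign f W wStar) {θ : Param d}
    (hθ : θ ∈ W) : maxMin f W θ = designValue f W θ (wStar θ) := by
  obtain ⟨h1, h2⟩ := hw θ hθ
  refine le_antisymm (csSup_le ⟨_, wStar θ, h1, rfl⟩ ?_)
    (le_csSup ⟨designValue f W θ (wStar θ), ?_⟩ ⟨_, h1, rfl⟩)
  · rintro _ ⟨w, hw, rfl⟩
    exact h2 hw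
  · rintro _ ⟨w, hw, rfl⟩
    exact h2 hw

lemma designValue_le_maxMin {wStar : Param d → Pair d → ℝ} (hw : IsOptimalDesign f W wStar)
    {θ : Param d} (hθ : θ ∈ W) {w : Pair d → ℝ} (hw' : w ∈ stdSimplex ℝ (Pair d)) :
    designValue f W θ w ≤ maxMin f W θ := by
  rw [maxMin_eq hw hθ]
  exact (hw θ hθ).2 hw'

lemma exists_maxMin_close (hr : IsRegularModel f W) (hsep : Separated f W)
    (halt : ∀ θ ∈ W, ∃ θ' ∈ W, RankNe θ θ') {wStar : Param d → Pair d → ℝ}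
    (hw : IsOptimalDesign f W wStar) {ε : ℝ} (hε : 0 < ε) :
    ∃ r > 0, ∀ θ ∈ W, ∀ θ' ∈ W, dist θ θ' < r → maxMin f W θ ≤ maxMin f W θ' + ε := by
  obtain ⟨r, hr0, h⟩ := hr.exists_designValue_close hsep halt hε
  refine ⟨r, hr0, fun θ hθ θ' hθ' hd => ?_⟩
  rw [maxMin_eq hw hθ]
  exact (h θ hθ θ' hθ' hd _ (hw θ hθ).1).trans
    (by gcongr; exact designValue_le_maxMin hw hθ' (hw θ hθ).1)

lemma continuousOn_maxMin (hr : IsRegularModel f W) (hsep : Separated f W)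
    (halt : ∀ θ ∈ W, ∃ θ' ∈ W, RankNe θ θ') {wStar : Param d → Pair d → ℝ}
    (hw : IsOptimalDesign f W wStar) : ContinuousOn (maxMin f W) W := by
  refine Metric.continuousOn_iff.2 fun θ hθ ε hε => ?_
  obtain ⟨r, hr0, h⟩ := hr.exists_maxMin_close hsep halt hw (half_pos hε)
  refine ⟨r, hr0, fun θ' hθ' hd => ?_⟩
  have h1 := h θ' hθ' θ hθ hd
  have h2 := h θ hθ θ' hθ' (by rwa [dist_comm])
  rw [Real.dist_eq, abs_lt]
  constructor <;> linarith

/-- The uniform design shows that the max-min value is bounded away from `0`. -/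
lemma exists_maxMin_ge (hr : IsRegularModel f W) (hsep : Separated f W)
    (halt : ∀ θ ∈ W, ∃ θ' ∈ W, RankNe θ θ') [Nonempty (Pair d)] {wStar : Param d → Pair d → ℝ}
    (hw : IsOptimalDesign f W wStar) : ∃ m > 0, ∀ θ ∈ W, m ≤ maxMin f W θ := by
  obtain ⟨η, hη, hs⟩ := hsep
  have hcard : (0 : ℝ) < Fintype.card (Pair d) := by exact_mod_cast Fintype.card_pos
  set u : Pair d → ℝ := fun _ => 1 / Fintype.card (Pair d) with hu
  have hu' : u ∈ stdSimplex ℝ (Pair d) := by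
    refine ⟨fun a => by positivity, ?_⟩
    simp only [hu, Finset.sum_const, Finset.card_univ, nsmul_eq_mul]
    field_simp
  refine ⟨1 / Fintype.card (Pair d) * η, by positivity, fun θ hθ =>
    le_trans ?_ (designValue_le_maxMin hw hθ hu')⟩
  obtain ⟨τ₀, hτ₀⟩ := halt θ hθ
  refine le_csInf ⟨_, τ₀, hτ₀, rfl⟩ ?_
  rintro _ ⟨τ, ⟨hτ, hne⟩, rfl⟩
  obtain ⟨a, ha⟩ := hs θ hθ τ hτ hne
  exact (mul_le_mul_of_nonneg_left ha (by positivity)).trans (Finset.single_le_sum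
    (f := fun a => u a * klPair f a θ τ)
    (fun a _ => mul_nonneg (hu'.1 a) (hr.klPair_nonneg hθ hτ a)) (Finset.mem_univ a))

lemma maxMin_le (hr : IsRegularModel f W) {B : ℝ}
    (hB : ∀ θ ∈ W, ∀ a x, |Real.log (f θ a x)| ≤ B)
    (halt : ∀ θ ∈ W, ∃ θ' ∈ W, RankNe θ θ') {wStar : Param d → Pair d → ℝ}
    (hw : IsOptimalDesign f W wStar) {θ : Param d} (hθ : θ ∈ W) : maxMin f W θ ≤ 2 * B := by
  obtain ⟨τ, hτ, hne⟩ := halt θ hθ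
  obtain ⟨h1, -⟩ := hw θ hθ
  rw [maxMin_eq hw hθ]
  refine (hr.designValue_le hθ hτ hne h1).trans ?_
  calc _ ≤ ∑ a, wStar θ a * (2 * B) := Finset.sum_le_sum fun a _ =>
        mul_le_mul_of_nonneg_left (hr.klPair_le hB hθ hτ a) (h1.1 a)
    _ = 2 * B := by rw [← Finset.sum_mul, h1.2, one_mul]

/-- A selection that is close to the optimal design of a nearby parameter discriminates nearly
optimally between `θ` and every alternative. No continuity of `wStar` is needed, because
`designValue` is continuous in the parameter uniformly over all designs. -/
lemma exists_information_ge (hr : IsRegularModel f W) (hsep : Separated f W)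
    (halt : ∀ θ ∈ W, ∃ θ' ∈ W, RankNe θ θ') {wStar : Param d → Pair d → ℝ}
    (hw : IsOptimalDesign f W wStar) {ε : ℝ} (hε : 0 < ε) :
    ∃ r > 0, ∀ θ ∈ W, ∀ θ' ∈ W, dist θ θ' < r → ∀ w ∈ stdSimplex ℝ (Pair d),
      ∑ a, |wStar θ' a - w a| ≤ r → ∀ τ ∈ W, RankNe θ τ →
        maxMin f W θ - ε ≤ ∑ a, w a * klPair f a θ τ := by
  obtain ⟨B, hB0, hB⟩ := hr.exists_log_bound
  have hε3 : 0 < ε / 3 := by positivity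
  obtain ⟨r₁, hr₁, h₁⟩ := hr.exists_designValue_close hsep halt hε3
  obtain ⟨r₂, hr₂, h₂⟩ := hr.exists_maxMin_close hsep halt hw hε3
  refine ⟨min (min r₁ r₂) (ε / 3 / (2 * B)), by positivity, ?_⟩
  intro θ hθ θ' hθ' hd w hw' hww τ hτ hne
  have hw1 := (hw θ' hθ').1
  have e1 := h₂ θ hθ θ' hθ' (hd.trans_le ((min_le_left _ _).trans (min_le_right _ _)))
  have e2 := h₁ θ' hθ' θ hθ (by
    rw [dist_comm]
    exact hd.trans_le ((min_le_left _ _).trans (min_le_left _ _))) _ hw1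
  rw [← maxMin_eq hw hθ'] at e2
  have e3 := hr.designValue_le hθ hτ hne hw1
  have e4 : ∑ a, wStar θ' a * klPair f a θ τ ≤
      ∑ a, (w a * klPair f a θ τ + |wStar θ' a - w a| * (2 * B)) :=
    Finset.sum_le_sum fun a _ => by
      have h5 := hr.klPair_nonneg hθ hτ a
      have h6 := mul_le_mul_of_nonneg_right (le_abs_self (wStar θ' a - w a)) h5
      have h7 := mul_le_mul_of_nonneg_left (hr.klPair_le hB hθ hτ a)
        (abs_nonneg (wStar θ' a - w a))
      linarith
  rw [Finset.sum_add_distrib, ← Finset.sum_mul] at e4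
  have e5 : (∑ a, |wStar θ' a - w a|) * (2 * B) ≤ ε / 3 := by
    have := mul_le_mul_of_nonneg_right (hww.trans (min_le_right _ _)) (by positivity : 0 ≤ 2 * B)
    rwa [div_mul_cancel₀ _ (by positivity)] at this
  linarith

end IsRegularModel

lemma nonempty_pair (hd : 1 ≤ d) : Nonempty (Pair d) :=
  ⟨⟨(0, Fin.last d), by
    rw [Fin.lt_def]
    simpa using (by omega : 0 < d)⟩⟩

/-- If every rank occurs in `W`, every parameter has an alternative of a different rank. -/
lemma exists_rankNe {W : Set (Param d)} (hd : 1 ≤ d) (hW : CompactSupport W) (θ : Param d) :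
    ∃ θ' ∈ W, RankNe θ θ' := by
  obtain ⟨σ, hσ⟩ := exists_isRank θ
  have : Nontrivial (Fin (d + 1)) := Fin.nontrivial_iff_two_le.2 (by omega)
  obtain ⟨σ', hσ'⟩ := exists_ne σ
  obtain ⟨θ', hθ'⟩ := hW.2 σ'
  obtain ⟨h1, h2⟩ := interior_subset hθ'
  exact ⟨θ', h2, σ, σ', hσ, h1, hσ'.symm⟩

lemma halfSupport_nonempty {W : Set (Param d)} (hW : CompactSupport W) (i j : Fin (d + 1)) :
    (halfSupport W i j).Nonempty := by
  obtain ⟨θ', hθ'⟩ := hW.2 (Equiv.swap 0 i)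
  obtain ⟨h1, h2⟩ := interior_subset hθ'
  refine ⟨θ', ?_, h2⟩
  have := h1 (Fin.zero_le (Equiv.swap 0 i j))
  simpa using this

/-! ### The likelihood ratio and the deviations of the outcome counts -/

/-- The record of the comparisons that precede comparison `k` in the record `h`. -/
def past {n : ℕ} (h : Hist d n) (k : Fin n) : Hist d k := fun j => h ⟨j, j.2.trans k.2⟩

/-- The number of occurrences of the observation `y = (a, x)` in the record `h`, centred by its
compensator: the sum of the conditional probabilities `λ_k^a g^a(x)` of this observation, when the
outcome of a comparison of the pair `a` has distribution `g a`. -/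
noncomputable def deviation (R : Rule d) (g : Pair d → Fin 2 → ℝ) {n : ℕ} (h : Hist d n)
    (y : Obs d) : ℝ :=
  ∑ k, ((if h k = y then 1 else 0) - R k (past h k) y.1 * g y.1 y.2)

/-- The log-likelihood ratio is the accumulated information plus a linear function of the
finitely many deviations. -/
lemma IsRegularModel.logLik_sub_logLik {f : Param d → Pair d → Fin 2 → ℝ} {W : Set (Param d)}
    (hr : IsRegularModel f W) (R : Rule d) {n : ℕ} (h : Hist d n) {θ τ : Param d} (hθ : θ ∈ W)
    (hτ : τ ∈ W) :
    logLik f h θ - logLik f h τ = ∑ k : Fin n, ∑ a, R k (past h k) a * klPair f a θ τ +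
      ∑ y : Obs d, deviation R (f θ) h y *
        (Real.log (f θ y.1 y.2) - Real.log (f τ y.1 y.2)) := by
  unfold logLik deviation
  simp_rw [Finset.sum_mul]
  rw [Finset.sum_comm (s := (Finset.univ : Finset (Obs d))), ← Finset.sum_sub_distrib,
    ← Finset.sum_add_distrib]
  refine Finset.sum_congr rfl fun k _ => ?_
  simp_rw [sub_mul, Finset.sum_sub_distrib, ite_mul, one_mul, zero_mul]
  rw [Finset.sum_ite_eq Finset.univ (h k), if_pos (Finset.mem_univ _), Fintype.sum_prod_type]
  have : ∀ a, R k (past h k) a * klPair f a θ τ = ∑ x, R k (past h k) a * f θ a x *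
      (Real.log (f θ a x) - Real.log (f τ a x)) := fun a => by
    rw [hr.klPair_eq hθ hτ, Finset.mul_sum]
    exact Finset.sum_congr rfl fun x _ => by ring
  simp_rw [this]
  ring

lemma IsRegularModel.le_logLik_sub_logLik {f : Param d → Pair d → Fin 2 → ℝ}
    {W : Set (Param d)} (hr : IsRegularModel f W) {B : ℝ}
    (hB : ∀ θ ∈ W, ∀ a x, |Real.log (f θ a x)| ≤ B) (R : Rule d) {n : ℕ} (h : Hist d n)
    {θ τ : Param d} (hθ : θ ∈ W) (hτ : τ ∈ W) {s : ℝ}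
    (hdev : ∀ y, |deviation R (f θ) h y| ≤ s) :
    ∑ k : Fin n, ∑ a, R k (past h k) a * klPair f a θ τ - Fintype.card (Obs d) * (2 * B) * s ≤
      logLik f h θ - logLik f h τ := by
  rw [hr.logLik_sub_logLik R h hθ hτ, sub_eq_add_neg]
  refine add_le_add_right ?_ _
  calc -(Fintype.card (Obs d) * (2 * B) * s) = ∑ _y : Obs d, -(s * (2 * B)) := by
        rw [Finset.sum_const, Finset.card_univ, nsmul_eq_mul]
        ring
    _ ≤ _ := Finset.sum_le_sum fun y _ => ?_
  have h1 := abs_le.1 (hB θ hθ y.1 y.2)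
  have h2 := abs_le.1 (hB τ hτ y.1 y.2)
  refine (neg_le_neg ?_).trans (neg_abs_le _)
  rw [abs_mul]
  exact mul_le_mul (hdev y) (abs_le.2 ⟨by linarith, by linarith⟩) (abs_nonneg _)
    ((abs_nonneg _).trans (hdev y))

/-! ### Law of the experiment -/

lemma deviation_history_succ (R : Rule d) (g : Pair d → Fin 2 → ℝ) {Ω : Type*} (Y : ℕ → Ω → Obs d)
    (n : ℕ) (ω : Ω) (y : Obs d) :
    deviation R g (history Y (n + 1) ω) y = deviation R g (history Y n ω) y +
      ((if Y n ω = y then 1 else 0) - R n (history Y n ω) y.1 * g y.1 y.2) := by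
  unfold deviation
  rw [Fin.sum_univ_castSucc]
  rfl

/-- The outcome probabilities, set to `0` outside `W`, which makes them measurable in the
parameter without changing them at the true parameter. -/
noncomputable def supportModel (f : Param d → Pair d → Fin 2 → ℝ) (W : Set (Param d)) (θ : Param d)
    (a : Pair d) (x : Fin 2) : ℝ :=
  W.indicator (fun θ => f θ a x) θ

lemma supportModel_eq {f : Param d → Pair d → Fin 2 → ℝ} {W : Set (Param d)} {θ : Param d}
    (hθ : θ ∈ W) : supportModel f W θ = f θ := by
  funext a x
  exact Set.indicator_of_mem hθ _

lemma measurable_indicator_of_continuousOn {W : Set (Param d)} (hW : IsCompact W)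
    {g : Param d → ℝ} (hg : ContinuousOn g W) : Measurable (W.indicator g) := by
  classical
  rw [← Set.piecewise_eq_indicator]
  exact hg.measurable_piecewise continuousOn_const hW.measurableSet

lemma IsRegularModel.measurable_supportModel {f : Param d → Pair d → Fin 2 → ℝ}
    {W : Set (Param d)} (hr : IsRegularModel f W) (a : Pair d) (x : Fin 2) :
    Measurable fun θ => supportModel f W θ a x :=
  measurable_indicator_of_continuousOn hr.isCompact (hr.continuousOn a x)

section Experiment

variable {f : Param d → Pair d → Fin 2 → ℝ} {ρ : Param d → ℝ} {R : Rule d} {Ω : Type*}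
  [MeasurableSpace Ω] {P : Measure Ω} {Θ : Ω → Param d} {Y : ℕ → Ω → Obs d}

lemma IsExperiment.measurable_history (he : IsExperiment f ρ R P Θ Y) (n : ℕ) :
    Measurable (history Y n) :=
  measurable_pi_iff.2 fun k => he.measurable_obs k

lemma IsExperiment.measure_univ (he : IsExperiment f ρ R P Θ Y) (hρ : IsPriorDensity ρ) :
    P Set.univ = 1 := by
  have h := congrArg (fun μ => μ Set.univ) he.law_param
  simpa [Measure.map_apply he.measurable_param MeasurableSet.univ, hρ.lintegral_eq_one] using h

lemma IsExperiment.ae_mem (he : IsExperiment f ρ R P Θ Y) (hρ : IsPriorDensity ρ) :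
    ∀ᵐ ω ∂P, Θ ω ∈ priorSupport ρ := by
  have hm : MeasurableSet (priorSupport ρ) := isClosed_closure.measurableSet
  refine ae_of_ae_map he.measurable_param.aemeasurable (p := fun θ => θ ∈ priorSupport ρ) ?_
  rw [he.law_param, ae_withDensity_iff hρ.measurable.ennreal_ofReal]
  refine ae_of_all _ fun θ hθ => subset_closure ?_
  have : ENNReal.ofReal (ρ θ) ≠ 0 := hθ
  simpa using this

lemma measurable_comp_history (he : IsExperiment f ρ R P Θ Y) {E : Type*} [MeasurableSpace E]
    {n : ℕ} {G : Param d → Hist d n → E} (hG : ∀ h, Measurable fun θ => G θ h) :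
    Measurable fun ω => G (Θ ω) (history Y n ω) :=
  (measurable_from_prod_countable_left (f := fun z : Param d × Hist d n => G z.1 z.2) hG).comp
    (he.measurable_param.prodMk (he.measurable_history n))

/-- The conditional law of comparison `n + 1`, for integrals over a single record. -/
lemma IsExperiment.setLIntegral_obs (he : IsExperiment f ρ R P Θ Y) (hρ : IsPriorDensity ρ)
    (hr : IsRegularModel f (priorSupport ρ)) (n : ℕ) (h : Hist d n) (y : Obs d)
    {G : Param d → ℝ≥0∞} (hG : Measurable G) :
    ∫⁻ ω in {ω | history Y n ω = h ∧ Y n ω = y}, G (Θ ω) ∂P =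
      ∫⁻ ω in {ω | history Y n ω = h},
        ENNReal.ofReal (R n h y.1 * supportModel f (priorSupport ρ) (Θ ω) y.1 y.2) *
          G (Θ ω) ∂P := by
  have hΘ := he.measurable_param
  set φ : Param d → ℝ≥0∞ := fun θ =>
    ENNReal.ofReal (R n h y.1 * supportModel f (priorSupport ρ) θ y.1 y.2) with hφ
  have hφm : Measurable φ := ((hr.measurable_supportModel _ _).const_mul _).ennreal_ofReal
  have hA : MeasurableSet {ω | history Y n ω = h} :=
    he.measurable_history n (measurableSet_singleton h)
  have hAy : MeasurableSet {ω | history Y n ω = h ∧ Y n ω = y} :=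
    hA.inter (he.measurable_obs n (measurableSet_singleton y))
  have key : (P.restrict {ω | history Y n ω = h ∧ Y n ω = y}).map Θ =
      ((P.restrict {ω | history Y n ω = h}).withDensity (φ ∘ Θ)).map Θ := by
    ext B hB
    rw [Measure.map_apply hΘ hB, Measure.map_apply hΘ hB, Measure.restrict_apply (hΘ hB),
      withDensity_apply _ (hΘ hB), Measure.restrict_restrict (hΘ hB)]
    refine (he.law_obs n h y.1 y.2 B hB).trans (lintegral_congr_ae ?_)
    filter_upwards [ae_restrict_of_ae (he.ae_mem hρ)] with ω hω
    simp only [hφ, Function.comp, supportModel_eq hω]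
  calc _ = ∫⁻ θ, G θ ∂((P.restrict {ω | history Y n ω = h ∧ Y n ω = y}).map Θ) :=
        (lintegral_map hG hΘ).symm
    _ = ∫⁻ ω, G (Θ ω) ∂((P.restrict {ω | history Y n ω = h}).withDensity (φ ∘ Θ)) := by
        rw [key, lintegral_map hG hΘ]
    _ = _ := by
        exact lintegral_withDensity_eq_lintegral_mul _ (hφm.comp hΘ) (hG.comp hΘ)

/-- The conditional law of comparison `n + 1`. -/
lemma IsExperiment.lintegral_obs (he : IsExperiment f ρ R P Θ Y) (hρ : IsPriorDensity ρ)
    (hr : IsRegularModel f (priorSupport ρ)) (n : ℕ) {G : Param d → Hist d n → Obs d → ℝ≥0∞}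
    (hG : ∀ h y, Measurable fun θ => G θ h y) :
    ∫⁻ ω, G (Θ ω) (history Y n ω) (Y n ω) ∂P = ∫⁻ ω, ∑ y : Obs d,
      ENNReal.ofReal (R n (history Y n ω) y.1 *
        supportModel f (priorSupport ρ) (Θ ω) y.1 y.2) * G (Θ ω) (history Y n ω) y ∂P := by
  classical
  have hΘ := he.measurable_param
  have hφm : ∀ h (y : Obs d), Measurable fun θ => ENNReal.ofReal (R n h y.1 *
      supportModel f (priorSupport ρ) θ y.1 y.2) * G θ h y := fun h y =>
    (((hr.measurable_supportModel _ _).const_mul _).ennreal_ofReal).mul (hG h y)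
  have hA : ∀ h, MeasurableSet {ω | history Y n ω = h} := fun h =>
    he.measurable_history n (measurableSet_singleton h)
  have hAy : ∀ h y, MeasurableSet {ω | history Y n ω = h ∧ Y n ω = y} := fun h y =>
    (hA h).inter (he.measurable_obs n (measurableSet_singleton y))
  have e1 : ∀ ω, G (Θ ω) (history Y n ω) (Y n ω) = ∑ h : Hist d n, ∑ y : Obs d,
      Set.indicator {ω | history Y n ω = h ∧ Y n ω = y} (fun ω => G (Θ ω) h y) ω := by
    intro ω
    rw [Finset.sum_eq_single (history Y n ω), Finset.sum_eq_single (Y n ω)]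
    · simp
    · intro y _ hy
      exact Set.indicator_of_notMem (fun hm => hy hm.2.symm) _
    · simp
    · intro h _ hh
      exact Finset.sum_eq_zero fun y _ => Set.indicator_of_notMem (fun hm => hh hm.1.symm) _
    · simp
  have e2 : ∀ ω, (∑ y : Obs d, ENNReal.ofReal (R n (history Y n ω) y.1 *
        supportModel f (priorSupport ρ) (Θ ω) y.1 y.2) * G (Θ ω) (history Y n ω) y) =
      ∑ h : Hist d n, ∑ y : Obs d, Set.indicator {ω | history Y n ω = h} (fun ω =>
        ENNReal.ofReal (R n h y.1 * supportModel f (priorSupport ρ) (Θ ω) y.1 y.2) *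
          G (Θ ω) h y) ω := by
    intro ω
    rw [Finset.sum_eq_single (history Y n ω)]
    · simp
    · intro h _ hh
      exact Finset.sum_eq_zero fun y _ => Set.indicator_of_notMem (fun hm => hh hm.symm) _
    · simp
  simp_rw [e1, e2]
  rw [lintegral_finsetSum, lintegral_finsetSum]
  · refine Finset.sum_congr rfl fun h _ => ?_
    rw [lintegral_finsetSum, lintegral_finsetSum]
    · refine Finset.sum_congr rfl fun y _ => ?_
      rw [lintegral_indicator (hAy h y), lintegral_indicator (hA h)]
      exact he.setLIntegral_obs hρ hr n h y (hG h y)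
    · exact fun y _ => ((hφm h y).comp hΘ).indicator (hA h)
    · exact fun y _ => ((hG h y).comp hΘ).indicator (hAy h y)
  · exact fun h _ => Finset.measurable_fun_sum _ fun y _ =>
      ((hφm h y).comp hΘ).indicator (hA h)
  · exact fun h _ => Finset.measurable_fun_sum _ fun y _ =>
      ((hG h y).comp hΘ).indicator (hAy h y)

/-! ### Concentration of the deviations -/

/-- The exponential moment of a centred Bernoulli variable. -/
lemma bernoulli_exp_le {q s : ℝ} (hq0 : 0 ≤ q) (hq1 : q ≤ 1) (hs : |s| ≤ 1) :
    q * Real.exp (s * (1 - q)) + (1 - q) * Real.exp (s * (0 - q)) ≤ Real.exp (s ^ 2) := by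
  have hb : ∀ v, |v| ≤ 1 → Real.exp (s * v) ≤ 1 + s * v + s ^ 2 := fun v hv => by
    have h1 : |s * v| ≤ |s| := by
      rw [abs_mul]
      exact mul_le_of_le_one_right (abs_nonneg _) hv
    have h2 := (le_abs_self _).trans (Real.abs_exp_sub_one_sub_id_le (h1.trans hs))
    have h3 : (s * v) ^ 2 ≤ s ^ 2 := sq_le_sq.2 h1
    linarith
  have h1 := mul_le_mul_of_nonneg_left
    (hb (1 - q) (abs_le.2 ⟨by linarith, by linarith⟩)) hq0
  have h2 := mul_le_mul_of_nonneg_left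
    (hb (0 - q) (abs_le.2 ⟨by linarith, by linarith⟩)) (sub_nonneg.2 hq1)
  have h3 := Real.add_one_le_exp (s ^ 2)
  nlinarith

lemma measurable_deviation_supportModel {W : Set (Param d)} (hr : IsRegularModel f W) {n : ℕ}
    (h : Hist d n) (y : Obs d) : Measurable fun θ => deviation R (supportModel f W θ) h y :=
  Finset.measurable_fun_sum _ fun _ _ =>
    measurable_const.sub ((hr.measurable_supportModel _ _).const_mul _)

/-- The deviations have sub-Gaussian exponential moments. -/
lemma IsExperiment.lintegral_exp_deviation_le (he : IsExperiment f ρ R P Θ Y)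
    (hρ : IsPriorDensity ρ) (hr : IsRegularModel f (priorSupport ρ)) (hR : IsRule R) (y : Obs d)
    {s : ℝ} (hs : |s| ≤ 1) (n : ℕ) :
    ∫⁻ ω, ENNReal.ofReal (Real.exp (s * deviation R (supportModel f (priorSupport ρ) (Θ ω))
      (history Y n ω) y)) ∂P ≤ ENNReal.ofReal (Real.exp (n * s ^ 2)) := by
  classical
  set g := supportModel f (priorSupport ρ) with hg
  induction n with
  | zero => simp [deviation, he.measure_univ hρ]
  | succ n ih =>
    simp_rw [deviation_history_succ]
    refine (he.lintegral_obs hρ hr n (G := fun θ h z => ENNReal.ofReal (Real.exp (s *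
      (deviation R (g θ) h y + ((if z = y then 1 else 0) - R n h y.1 * g θ y.1 y.2)))))
      fun h z => ?_).trans_le ?_
    · exact (Real.measurable_exp.comp (((measurable_deviation_supportModel hr h y).add
        (measurable_const.sub
          ((hr.measurable_supportModel _ _).const_mul _))).const_mul _)).ennreal_ofReal
    calc _ ≤ ∫⁻ ω, ENNReal.ofReal (Real.exp (s ^ 2)) * ENNReal.ofReal (Real.exp (s *
          deviation R (g (Θ ω)) (history Y n ω) y)) ∂P := lintegral_mono_ae ?_
      _ ≤ ENNReal.ofReal (Real.exp (s ^ 2)) * ENNReal.ofReal (Real.exp (n * s ^ 2)) := by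
          rw [lintegral_const_mul _ (measurable_comp_history he (G := fun θ h =>
            ENNReal.ofReal (Real.exp (s * deviation R (g θ) h y))) fun h =>
              (Real.measurable_exp.comp ((measurable_deviation_supportModel hr h
                y).const_mul _)).ennreal_ofReal)]
          gcongr
      _ = _ := by
          rw [← ENNReal.ofReal_mul (Real.exp_pos _).le, ← Real.exp_add]
          congr 2
          push_cast
          ring
    filter_upwards [he.ae_mem hρ] with ω hω
    set h := history Y n ω
    set v := deviation R (g (Θ ω)) h y
    have hgω : g (Θ ω) = f (Θ ω) := supportModel_eq hω
    simp only [hgω, supportModel_eq hω]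
    -- the conditional probabilities of the observations form a probability vector
    set π : Obs d → ℝ := fun z => R n h z.1 * f (Θ ω) z.1 z.2 with hπ
    have hπ0 : ∀ z, 0 ≤ π z := fun z => mul_nonneg ((hR n h).1 _) (hr.pos _ hω _ _).le
    have hπ1 : ∑ z, π z = 1 := by
      rw [Fintype.sum_prod_type]
      simp_rw [hπ, ← Finset.mul_sum, (hr.model _ hω _).2, mul_one]
      exact (hR n h).2
    have hsplit := Finset.add_sum_erase Finset.univ π (Finset.mem_univ y)
    have hle : π y ≤ 1 := hπ1 ▸ Finset.single_le_sum (fun z _ => hπ0 z) (Finset.mem_univ y)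
    have hterm : ∀ z : Obs d, ENNReal.ofReal (R n h z.1 * f (Θ ω) z.1 z.2) *
        ENNReal.ofReal (Real.exp (s * (v + ((if z = y then 1 else 0) - R n h y.1 *
          f (Θ ω) y.1 y.2)))) = ENNReal.ofReal (π z *
            Real.exp (s * (v + ((if z = y then 1 else 0) - π y)))) := fun z =>
      (ENNReal.ofReal_mul (hπ0 z)).symm
    refine (Finset.sum_congr rfl fun z _ => hterm z).trans_le ?_
    rw [← ENNReal.ofReal_sum_of_nonneg fun z _ => mul_nonneg (hπ0 z) (Real.exp_pos _).le,
      ← ENNReal.ofReal_mul (Real.exp_pos _).le]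
    refine ENNReal.ofReal_le_ofReal ?_
    rw [← Finset.add_sum_erase _ _ (Finset.mem_univ y), if_pos rfl]
    have e1 : ∑ z ∈ Finset.univ.erase y,
        π z * Real.exp (s * (v + ((if z = y then 1 else 0) - π y))) =
        (1 - π y) * Real.exp (s * (v + (0 - π y))) := by
      rw [← hπ1, ← hsplit, add_sub_cancel_left, Finset.sum_mul]
      exact Finset.sum_congr rfl fun z hz => by rw [if_neg (Finset.ne_of_mem_erase hz)]
    rw [e1, mul_add, mul_add, Real.exp_add, Real.exp_add]
    have := mul_le_mul_of_nonneg_right (bernoulli_exp_le (hπ0 y) hle hs) (Real.exp_pos (s * v)).le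
    linarith

/-- The times at which some outcome count deviates from its compensator by more than `t` per
comparison. -/
def deviationTimes (R : Rule d) (g : Pair d → Fin 2 → ℝ) (Y : ℕ → Ω → Obs d) (t : ℝ) (ω : Ω) :
    Set ℕ :=
  {n | ∃ y, t * n < |deviation R g (history Y n ω) y|}

lemma IsExperiment.measure_deviation_le (he : IsExperiment f ρ R P Θ Y)
    (hρ : IsPriorDensity ρ) (hr : IsRegularModel f (priorSupport ρ)) (hR : IsRule R) {t : ℝ}
    (ht0 : 0 < t) (ht1 : t ≤ 1) (n : ℕ) :
    P {ω | n ∈ deviationTimes R (supportModel f (priorSupport ρ) (Θ ω)) Y t ω} ≤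
      Fintype.card (Obs d) * 2 * ENNReal.ofReal (Real.exp (-(t ^ 2 / 4))) ^ n := by
  set g := supportModel f (priorSupport ρ) with hg
  -- Markov's inequality for `exp (s * deviation)` with the optimal `s = ± t / 2`
  have key : ∀ (y : Obs d) (s : ℝ), |s| = t / 2 →
      P {ω | t / 2 * (t * n) ≤ s * deviation R (g (Θ ω)) (history Y n ω) y} ≤
        ENNReal.ofReal (Real.exp (-(t ^ 2 / 4))) ^ n := by
    intro y s hs
    have hs2 : s ^ 2 = t ^ 2 / 4 := by
      rw [← sq_abs, hs]
      ring
    have hm : Measurable fun ω => ENNReal.ofReal (Real.exp (s *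
        deviation R (g (Θ ω)) (history Y n ω) y)) :=
      measurable_comp_history he (G := fun θ h =>
        ENNReal.ofReal (Real.exp (s * deviation R (g θ) h y))) fun h =>
          (Real.measurable_exp.comp
            ((measurable_deviation_supportModel hr h y).const_mul _)).ennreal_ofReal
    have h1 := meas_ge_le_lintegral_div hm.aemeasurable (μ := P)
      (ε := ENNReal.ofReal (Real.exp (t / 2 * (t * n))))
      (ENNReal.ofReal_pos.2 (Real.exp_pos _)).ne' ENNReal.ofReal_ne_top
    have h2 := he.lintegral_exp_deviation_le hρ hr hR y (s := s) (by rw [hs]; linarith) n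
    calc _ ≤ P {ω | ENNReal.ofReal (Real.exp (t / 2 * (t * n))) ≤ ENNReal.ofReal (Real.exp (s *
          deviation R (g (Θ ω)) (history Y n ω) y))} := measure_mono fun ω hω =>
            ENNReal.ofReal_le_ofReal (Real.exp_le_exp.2 hω)
      _ ≤ _ := h1
      _ ≤ ENNReal.ofReal (Real.exp (n * s ^ 2)) /
          ENNReal.ofReal (Real.exp (t / 2 * (t * n))) := by gcongr
      _ = _ := by
        rw [← ENNReal.ofReal_div_of_pos (Real.exp_pos _), ← Real.exp_sub,
          ← ENNReal.ofReal_pow (Real.exp_pos _).le, ← Real.exp_nat_mul, hs2]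
        congr 2
        ring
  have hsub : {ω | n ∈ deviationTimes R (g (Θ ω)) Y t ω} ⊆ ⋃ y : Obs d,
      ({ω | t / 2 * (t * n) ≤ t / 2 * deviation R (g (Θ ω)) (history Y n ω) y} ∪
        {ω | t / 2 * (t * n) ≤ -(t / 2) * deviation R (g (Θ ω)) (history Y n ω) y}) := by
    rintro ω ⟨y, hy⟩
    refine Set.mem_iUnion.2 ⟨y, ?_⟩
    rcases lt_abs.1 hy with h | h
    · exact Or.inl (mul_le_mul_of_nonneg_left h.le (by positivity))
    · refine Or.inr ?_
      have := mul_le_mul_of_nonneg_left h.le (by positivity : 0 ≤ t / 2)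
      simp only [Set.mem_ofPred_eq]
      linarith
  have habs : |t / 2| = t / 2 := abs_of_pos (by positivity)
  calc _ ≤ ∑ y : Obs d, P _ := (measure_mono hsub).trans (measure_iUnion_fintype_le _ _)
    _ ≤ ∑ _y : Obs d, 2 * ENNReal.ofReal (Real.exp (-(t ^ 2 / 4))) ^ n := by
        refine Finset.sum_le_sum fun y _ => (measure_union_le _ _).trans ?_
        rw [two_mul]
        exact add_le_add (key y _ habs) (key y _ (by rw [abs_neg, habs]))
    _ = _ := by
        rw [Finset.sum_const, Finset.card_univ, nsmul_eq_mul, mul_assoc]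

lemma measurableSet_mem_deviationTimes (he : IsExperiment f ρ R P Θ Y)
    (hr : IsRegularModel f (priorSupport ρ)) (t : ℝ) (n : ℕ) :
    MeasurableSet {ω | n ∈ deviationTimes R (supportModel f (priorSupport ρ) (Θ ω)) Y t ω} := by
  have : {ω | n ∈ deviationTimes R (supportModel f (priorSupport ρ) (Θ ω)) Y t ω} =
      ⋃ y : Obs d, {ω | t * n <
        |deviation R (supportModel f (priorSupport ρ) (Θ ω)) (history Y n ω) y|} := by
    ext ω
    simp [deviationTimes]
  rw [this]
  refine MeasurableSet.iUnion fun y => measurableSet_lt measurable_const ?_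
  exact (measurable_comp_history he (G := fun θ h =>
    deviation R (supportModel f (priorSupport ρ) θ) h y) fun h =>
      measurable_deviation_supportModel hr h y).abs

lemma encard_eq_tsum (S : Set ℕ) : (S.encard : ℝ≥0∞) = ∑' n, S.indicator 1 n := by
  rw [← Measure.count_apply MeasurableSet.of_discrete,
    ← lintegral_indicator_one MeasurableSet.of_discrete, lintegral_count]

lemma measurable_encard_deviationTimes (he : IsExperiment f ρ R P Θ Y)
    (hr : IsRegularModel f (priorSupport ρ)) (t : ℝ) :
    Measurable fun ω => ((deviationTimes R (supportModel f (priorSupport ρ) (Θ ω)) Y t ω).encard :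
      ℝ≥0∞) := by
  simp_rw [encard_eq_tsum]
  exact Measurable.tsum fun n =>
    measurable_const.indicator (measurableSet_mem_deviationTimes he hr t n)

/-- The expected number of times with a large deviation is finite, and of order `t ^ (-2)`. -/
lemma IsExperiment.lintegral_encard_deviationTimes_le (he : IsExperiment f ρ R P Θ Y)
    (hρ : IsPriorDensity ρ) (hr : IsRegularModel f (priorSupport ρ)) (hR : IsRule R) {t : ℝ}
    (ht0 : 0 < t) (ht1 : t ≤ 1) :
    ∫⁻ ω, ((deviationTimes R (supportModel f (priorSupport ρ) (Θ ω)) Y t ω).encard : ℝ≥0∞) ∂P ≤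
      ENNReal.ofReal (Fintype.card (Obs d) * 2 * (1 + 4 / t ^ 2)) := by
  simp_rw [encard_eq_tsum]
  refine (lintegral_tsum fun n => (measurable_const.indicator
    (measurableSet_mem_deviationTimes he hr t n)).aemeasurable).trans_le ?_
  have h1 : ∀ n, ∫⁻ ω, Set.indicator
      (deviationTimes R (supportModel f (priorSupport ρ) (Θ ω)) Y t ω) 1 n ∂P ≤
      Fintype.card (Obs d) * 2 * ENNReal.ofReal (Real.exp (-(t ^ 2 / 4))) ^ n := fun n =>
    (lintegral_indicator_one (measurableSet_mem_deviationTimes he hr t n)).trans_le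
      (he.measure_deviation_le hρ hr hR ht0 ht1 n)
  refine (ENNReal.tsum_le_tsum h1).trans ?_
  rw [ENNReal.tsum_mul_left, ENNReal.tsum_geometric, ENNReal.ofReal_mul (by positivity),
    ENNReal.ofReal_mul (by positivity), ENNReal.ofReal_natCast, ENNReal.ofReal_ofNat]
  gcongr
  have ha : 0 < t ^ 2 / 4 := by positivity
  have h2 : Real.exp (-(t ^ 2 / 4)) ≤ (1 + t ^ 2 / 4)⁻¹ := by
    rw [Real.exp_neg]
    exact inv_anti₀ (by positivity) (by linarith [Real.add_one_le_exp (t ^ 2 / 4)])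
  have h3 : (1 + 4 / t ^ 2)⁻¹ ≤ 1 - Real.exp (-(t ^ 2 / 4)) := by
    have : (1 + 4 / t ^ 2)⁻¹ = 1 - (1 + t ^ 2 / 4)⁻¹ := by
      field_simp
      ring
    linarith
  rw [← ENNReal.ofReal_one, ← ENNReal.ofReal_sub _ (Real.exp_pos _).le,
    ← inv_inv (1 + 4 / t ^ 2), ENNReal.ofReal_inv_of_pos (by positivity)]
  exact ENNReal.inv_le_inv.2 (ENNReal.ofReal_le_ofReal h3)

end Experiment

/-! ### The stopping criteria along a path -/

lemma IsRegularModel.le_glr {f : Param d → Pair d → Fin 2 → ℝ} {W : Set (Param d)}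
    (hr : IsRegularModel f W) (hsep : Separated f W) (hW : CompactSupport W) {n : ℕ}
    (h : Hist d n) {θ : Param d} (hθ : θ ∈ W) {H : ℝ}
    (hH : ∀ τ ∈ W, RankNe θ τ → H ≤ logLik f h θ - logLik f h τ) (p : Pair d) :
    H ≤ glr f W h p := by
  obtain ⟨B, -, hB⟩ := hr.exists_log_bound
  have hbdd : ∀ i j, BddAbove (logLik f h '' halfSupport W i j) := by
    rintro i j
    refine ⟨∑ _k : Fin n, B, ?_⟩
    rintro _ ⟨τ, hτ, rfl⟩
    exact Finset.sum_le_sum fun k _ => (le_abs_self _).trans (hB τ hτ.2 _ _)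
  have key : ∀ i j, score θ j < score θ i → H ≤ sSup (logLik f h '' halfSupport W i j) -
      sSup (logLik f h '' halfSupport W j i) := by
    intro i j hij
    have h1 : logLik f h θ ≤ sSup (logLik f h '' halfSupport W i j) :=
      le_csSup (hbdd i j) ⟨θ, ⟨hij.le, hθ⟩, rfl⟩
    have h2 : sSup (logLik f h '' halfSupport W j i) ≤ logLik f h θ - H := by
      refine csSup_le ((halfSupport_nonempty hW j i).image _) ?_
      rintro _ ⟨τ, hτ, rfl⟩
      have := hH τ hτ.2 (rankNe_of_reversed hij hτ.1 (hr.not_rankNe_self hsep hτ.2))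
      linarith
    linarith
  rcases lt_trichotomy (score θ p.1.1) (score θ p.1.2) with hlt | heq | hgt
  · exact (key _ _ hlt).trans (by rw [glr, abs_sub_comm]; exact le_abs_self _)
  · exact (hr.not_rankNe_self hsep hθ (rankNe_self_of_tie p.2.ne heq)).elim
  · exact (key _ _ hgt).trans (le_abs_self _)

/-- Raising the threshold by `log |𝒜|` turns the criterion on the minimum into the one on the
exponential sum. -/
lemma stopTime₁_le {f : Param d → Pair d → Fin 2 → ℝ} {W : Set (Param d)} {α c : ℝ} {Ω : Type*}
    {Y : ℕ → Ω → Obs d} {ω : Ω} [Nonempty (Pair d)] {n : ℕ} (hn : 1 < n)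
    (h : ∀ p, threshold α c + Real.log (Fintype.card (Pair d)) ≤ glr f W (history Y n ω) p) :
    stopTime₁ f W α c Y ω ≤ n := by
  have hcard : (0 : ℝ) < Fintype.card (Pair d) := by exact_mod_cast Fintype.card_pos
  refine iInf₂_le n ⟨hn, ?_⟩
  calc _ ≤ ∑ _p : Pair d, Real.exp (-(threshold α c + Real.log (Fintype.card (Pair d)))) :=
        Finset.sum_le_sum fun p _ => Real.exp_le_exp.2 (neg_le_neg (h p))
    _ = _ := by
        rw [Finset.sum_const, Finset.card_univ, nsmul_eq_mul, neg_add, Real.exp_add,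
          Real.exp_neg (Real.log _), Real.exp_log hcard]
        field_simp

lemma stopTime₂_le {f : Param d → Pair d → Fin 2 → ℝ} {W : Set (Param d)} {α c : ℝ} {Ω : Type*}
    {Y : ℕ → Ω → Obs d} {ω : Ω} [Nonempty (Pair d)] {n : ℕ} (hn : 1 < n)
    (h : ∀ p, threshold α c + Real.log (Fintype.card (Pair d)) ≤ glr f W (history Y n ω) p) :
    stopTime₂ f W α c Y ω ≤ n := by
  have hcard : (1 : ℝ) ≤ Fintype.card (Pair d) := by exact_mod_cast Fintype.card_pos
  have := Real.log_nonneg hcard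
  exact iInf₂_le n ⟨hn, fun p => le_trans (by linarith) (h p)⟩

/-- A time that is reached as soon as a bound linear in the number of exceptional times `F` holds
outside the set `A` of bad times exceeds this bound by at most the number of bad times. -/
lemma stopping_bound {T : ℕ∞} {F A : Set ℕ} {H ε : ℝ} (hH : 0 ≤ H) (hε : 0 < ε)
    (hT : ∀ n : ℕ, 1 < n → n ∉ A → (1 + ε) * (H + ((F ∩ Set.Iio n).ncard : ℝ)) ≤ n →
      T ≤ n) :
    (T : ℝ≥0∞) ≤ 3 + ENNReal.ofReal (1 + ε) * (ENNReal.ofReal H + F.encard) + A.encard := by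
  have hε0 : ENNReal.ofReal (1 + ε) ≠ 0 := (ENNReal.ofReal_pos.2 (by linarith)).ne'
  rcases A.finite_or_infinite with hA | hA
  swap
  · simp [hA.encard_eq]
  rcases F.finite_or_infinite with hF | hF
  swap
  · simp [hF.encard_eq, ENNReal.mul_top hε0]
  lift A to Finset ℕ using hA
  lift F to Finset ℕ using hF
  set x : ℝ := (1 + ε) * (H + F.card) with hx
  have hx0 : 0 ≤ x := by positivity
  set m : ℕ := ⌈x⌉₊ + 2 with hm
  obtain ⟨n, hn, hnA⟩ : ∃ n ∈ Finset.Icc m (m + A.card), n ∉ A := by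
    by_contra! hc
    have := Finset.card_le_card (show Finset.Icc m (m + A.card) ⊆ A from hc)
    rw [Nat.card_Icc] at this
    omega
  obtain ⟨h1, h2⟩ := Finset.mem_Icc.1 hn
  have hxn : x ≤ n := (Nat.le_ceil x).trans (by exact_mod_cast (by omega : ⌈x⌉₊ ≤ n))
  have hTn : T ≤ n := hT n (by omega) (by simpa using hnA) (le_trans (by
    have : (((F : Set ℕ) ∩ Set.Iio n).ncard : ℝ) ≤ F.card := by
      rw [← Set.ncard_coe_finset F]
      exact_mod_cast Set.ncard_le_ncard Set.inter_subset_left F.finite_toSet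
    exact mul_le_mul_of_nonneg_left (by linarith) (by linarith)) hxn)
  have hTm : (T : ℝ≥0∞) ≤ ((m + A.card : ℕ) : ℝ≥0∞) := by
    have : T ≤ ((m + A.card : ℕ) : ℕ∞) := hTn.trans (by exact_mod_cast h2)
    exact_mod_cast ENat.toENNReal_le.2 this
  have hmx : (m : ℝ≥0∞) ≤ 3 + ENNReal.ofReal x := by
    have : (m : ℝ) ≤ 3 + x := by
      have := Nat.ceil_lt_add_one hx0
      rw [hm]
      push_cast
      linarith
    calc (m : ℝ≥0∞) = ENNReal.ofReal m := (ENNReal.ofReal_natCast m).symm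
      _ ≤ ENNReal.ofReal (3 + x) := ENNReal.ofReal_le_ofReal this
      _ = _ := by rw [ENNReal.ofReal_add (by norm_num) hx0, ENNReal.ofReal_ofNat]
  have hxe : ENNReal.ofReal x = ENNReal.ofReal (1 + ε) * (ENNReal.ofReal H + F.card) := by
    rw [hx, ENNReal.ofReal_mul (by linarith), ENNReal.ofReal_add hH (by positivity),
      ENNReal.ofReal_natCast]
  rw [hxe] at hmx
  refine hTm.trans ?_
  push_cast
  simp only [Set.encard_coe_eq_coe_finsetCard, ENat.toENNReal_coe]
  gcongr

/-- Where no outcome count deviates much, the maximum likelihood estimator is close to the true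
parameter: a distant parameter has a smaller likelihood, since exploration at rate `p`
distinguishes it from the true one at rate `p * κ`. -/
lemma IsRegularModel.dist_mle_lt {f : Param d → Pair d → Fin 2 → ℝ} {W : Set (Param d)}
    (hr : IsRegularModel f W) {B : ℝ} (hB : ∀ θ ∈ W, ∀ a x, |Real.log (f θ a x)| ≤ B)
    {mle : (n : ℕ) → Hist d n → Param d} (hmle : IsMLE f W mle) {r κ : ℝ}
    (hκ : ∀ θ ∈ W, ∀ θ' ∈ W, r ≤ dist θ θ' → κ ≤ ∑ a, klPair f a θ θ') (R : Rule d) {Ω : Type*}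
    {Y : ℕ → Ω → Obs d} {ω : Ω} {p s : ℝ} (hp : 0 < p)
    (hexp : ∀ n a, p ≤ R n (history Y n ω) a) (hs : Fintype.card (Obs d) * (2 * B) * s < κ)
    {θ : Param d} (hθ : θ ∈ W) {n : ℕ} (hn : n ≠ 0) (hnd : n ∉ deviationTimes R (f θ) Y (s * p) ω) :
    dist θ (mle n (history Y n ω)) < r := by
  by_contra! hc
  obtain ⟨h1, h2⟩ := hmle n (history Y n ω)
  have hkl := hκ θ hθ _ h1 hc
  have hn0 : (0 : ℝ) < n := by positivity
  simp only [deviationTimes, Set.mem_ofPred_eq, not_exists, not_lt] at hnd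
  have h3 := hr.le_logLik_sub_logLik hB R _ hθ h1 hnd
  have h4 : logLik f (history Y n ω) θ ≤ logLik f (history Y n ω) (mle n (history Y n ω)) := h2 hθ
  have h5 : n * (p * κ) ≤ ∑ k : Fin n, ∑ a, R k (past (history Y n ω) k) a *
      klPair f a θ (mle n (history Y n ω)) := by
    calc n * (p * κ) = ∑ _k : Fin n, p * κ := by simp
      _ ≤ _ := Finset.sum_le_sum fun k _ => ?_
    calc p * κ ≤ p * ∑ a, klPair f a θ (mle n (history Y n ω)) := by gcongr
      _ ≤ _ := by
        rw [Finset.mul_sum]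
        exact Finset.sum_le_sum fun a _ =>
          mul_le_mul_of_nonneg_right (hexp k a) (hr.klPair_nonneg hθ h1 a)
  have h6 : 0 < n * p * (κ - Fintype.card (Obs d) * (2 * B) * s) :=
    mul_pos (by positivity) (by linarith)
  nlinarith

/-- Accumulation of information: each comparison outside `F` contributes at least `D - e`. -/
lemma IsRegularModel.le_logLik_sub_of_information {f : Param d → Pair d → Fin 2 → ℝ}
    {W : Set (Param d)} (hr : IsRegularModel f W) {B : ℝ}
    (hB : ∀ θ ∈ W, ∀ a x, |Real.log (f θ a x)| ≤ B) {R : Rule d} (hR : IsRule R) {Ω : Type*}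
    {Y : ℕ → Ω → Obs d} {ω : Ω} {F : Set ℕ} {θ τ : Param d} (hθ : θ ∈ W) (hτ : τ ∈ W) {q t : ℝ}
    (hF : ∀ k ∉ F, q ≤ ∑ a, R k (history Y k ω) a * klPair f a θ τ) {n : ℕ}
    (hn : n ∉ deviationTimes R (f θ) Y t ω) :
    q * (n - ((F ∩ Set.Iio n).ncard : ℝ)) - Fintype.card (Obs d) * (2 * B) * (t * n) ≤
      logLik f (history Y n ω) θ - logLik f (history Y n ω) τ := by
  simp only [deviationTimes, Set.mem_ofPred_eq, not_exists, not_lt] at hn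
  refine le_trans (sub_le_sub_right ?_ _) (hr.le_logLik_sub_logLik hB R _ hθ hτ hn)
  classical
  have hcoe : F ∩ Set.Iio n = ({k ∈ Finset.range n | k ∈ F} : Finset ℕ) := by
    ext k
    simp [and_comm]
  rw [hcoe, Set.ncard_coe_finset]
  have hcard : (({k ∈ Finset.range n | k ∉ F}.card : ℕ) : ℝ) =
      n - ({k ∈ Finset.range n | k ∈ F}.card : ℝ) := by
    have := Finset.card_filter_add_card_filter_not (s := Finset.range n) (fun k => k ∈ F)
    rw [Finset.card_range] at this
    have h : (({k ∈ Finset.range n | k ∈ F}.card : ℕ) : ℝ) +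
      ({k ∈ Finset.range n | k ∉ F}.card : ℕ) = n := by exact_mod_cast this
    linarith
  calc _ = ∑ k ∈ Finset.range n, if k ∉ F then q else 0 := by
        rw [← Finset.sum_filter, Finset.sum_const, nsmul_eq_mul, hcard, mul_comm]
    _ = ∑ k : Fin n, if (k : ℕ) ∉ F then q else 0 :=
        (Fin.sum_univ_eq_sum_range (fun k => if k ∉ F then q else 0) n).symm
    _ ≤ _ := Finset.sum_le_sum fun k _ => ?_
  split_ifs with hk
  · exact hr.sum_mul_klPair_nonneg hθ hτ (hR k _)
  · exact hF k hk

/-! ### The expected value of `t_c` -/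

/-- The reciprocal of the max-min value, set to `0` outside `W`. -/
noncomputable def invValue (f : Param d → Pair d → Fin 2 → ℝ) (W : Set (Param d)) :
    Param d → ℝ :=
  W.indicator fun θ => (maxMin f W θ)⁻¹

lemma expectedTc_eq (f : Param d → Pair d → Fin 2 → ℝ) (ρ : Param d → ℝ) (c : ℝ) :
    expectedTc f ρ c = |Real.log c| * ∫ θ, invValue f (priorSupport ρ) θ * ρ θ := by
  have hm : MeasurableSet (priorSupport ρ) := isClosed_closure.measurableSet
  rw [← integral_const_mul, expectedTc, ← integral_indicator hm]
  congr 1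
  funext θ
  by_cases hθ : θ ∈ priorSupport ρ
  · simp only [invValue, Set.indicator_of_mem hθ, tc]
    ring
  · simp [invValue, Set.indicator_of_notMem hθ]

lemma IsExperiment.lintegral_invValue {f : Param d → Pair d → Fin 2 → ℝ} {ρ : Param d → ℝ}
    {R : Rule d} {Ω : Type*} [MeasurableSpace Ω] {P : Measure Ω} {Θ : Ω → Param d}
    {Y : ℕ → Ω → Obs d} (he : IsExperiment f ρ R P Θ Y) (hρ : IsPriorDensity ρ)
    (hm : Measurable (invValue f (priorSupport ρ))) (h0 : ∀ θ, 0 ≤ invValue f (priorSupport ρ) θ)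
    {M : ℝ} (hM : ∀ θ, invValue f (priorSupport ρ) θ ≤ M) :
    ∫⁻ ω, ENNReal.ofReal (invValue f (priorSupport ρ) (Θ ω)) ∂P =
      ENNReal.ofReal (∫ θ, invValue f (priorSupport ρ) θ * ρ θ) := by
  set g := invValue f (priorSupport ρ)
  have e1 : ∫⁻ ω, ENNReal.ofReal (g (Θ ω)) ∂P = ∫⁻ θ, ENNReal.ofReal (g θ * ρ θ) := by
    rw [← lintegral_map (f := fun θ => ENNReal.ofReal (g θ)) hm.ennreal_ofReal
      he.measurable_param, he.law_param,
      lintegral_withDensity_eq_lintegral_mul _ hρ.measurable.ennreal_ofReal hm.ennreal_ofReal]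
    refine lintegral_congr fun θ => ?_
    rw [Pi.mul_apply, mul_comm, ENNReal.ofReal_mul (h0 θ)]
  have hfin : ∫⁻ ω, ENNReal.ofReal (g (Θ ω)) ∂P ≠ ∞ := by
    refine ((lintegral_mono fun ω => ENNReal.ofReal_le_ofReal (hM (Θ ω))).trans_lt ?_).ne
    rw [lintegral_const, he.measure_univ hρ, mul_one]
    exact ENNReal.ofReal_lt_top
  rw [integral_eq_lintegral_of_nonneg_ae (ae_of_all _ fun θ => mul_nonneg (h0 θ) (hρ.nonneg θ))
    (hm.mul hρ.measurable).aestronglyMeasurable, ← e1, ENNReal.ofReal_toReal hfin]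

/-! ### The asymptotic bound -/

/-- An explicit bound for the expected stopping time divided by `𝔼 t_c`, as a function of
`L = |log c|`. -/
lemma tendsto_ratio_bound {α δ : ℝ} (hα : 0 < α) (hδ : 0 < δ) (q l a b : ℝ) :
    Tendsto (fun L : ℝ => q * (1 + L ^ (-α) + l / L) + (a / L + b * L ^ (-(2 * δ)))) atTop
      (𝓝 q) := by
  have h1 := tendsto_rpow_neg_atTop hα
  have h2 := tendsto_rpow_neg_atTop (by positivity : 0 < 2 * δ)
  have h3 : ∀ l : ℝ, Tendsto (fun L : ℝ => l / L) atTop (𝓝 0) := fun l =>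
    tendsto_const_nhds.div_atTop tendsto_id
  have := ((((tendsto_const_nhds (x := (1 : ℝ))).add h1).add (h3 l)).const_mul q).add
    ((h3 a).add (h2.const_mul b))
  simpa using this

/-- The pathwise bound of the stopping time, integrated: the expected time is at most
`(1 + ε) 𝔼 t_c` up to terms that exploration at rate `p` makes of order `p ^ (-2)`. -/
lemma exists_expectedTime_le (hd : 1 ≤ d) {f : Param d → Pair d → Fin 2 → ℝ} {ρ : Param d → ℝ}
    {α : ℝ} (hρ : IsPriorDensity ρ) (hr : IsRegularModel f (priorSupport ρ))
    (hcompact : CompactSupport (priorSupport ρ)) (hsep : Separated f (priorSupport ρ))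
    (hident : Identifiable f (priorSupport ρ))
    {mle : (n : ℕ) → Hist d n → Param d} (hmle : IsMLE f (priorSupport ρ) mle)
    {wStar : Param d → Pair d → ℝ} (hwStar : IsOptimalDesign f (priorSupport ρ) wStar)
    {ε : ℝ} (hε : 0 < ε) :
    ∃ r > 0, ∃ a b : ℝ, 0 ≤ a ∧ 0 ≤ b ∧ ∀ {R : Rule d} {c p : ℝ} {Ω : Type*} [MeasurableSpace Ω]
      {P : Measure Ω} {Θ : Ω → Param d} {Y : ℕ → Ω → Obs d} {T : Ω → ℕ∞},
      IsExperiment f ρ R P Θ Y → IsRule R → 0 < p → p ≤ 1 →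
      (∀ᵐ ω ∂P, ∀ n a, p ≤ R n (history Y n ω) a) →
      (∀ᵐ ω ∂P, ∀ n ≥ 1,
        ∑ a, |wStar (mle n (history Y n ω)) a - R n (history Y n ω) a| ≤ r) →
      (∀ ω (n : ℕ), 1 < n → (∀ p, threshold α c + Real.log (Fintype.card (Pair d)) ≤
        glr f (priorSupport ρ) (history Y n ω) p) → T ω ≤ n) →
      0 < ∫ θ, invValue f (priorSupport ρ) θ * ρ θ ∧
      expectedTime P T ≤ ENNReal.ofReal ((1 + ε) * ((threshold α c +
        Real.log (Fintype.card (Pair d))) * ∫ θ, invValue f (priorSupport ρ) θ * ρ θ) +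
          (a + b / p ^ 2)) := by
  set W := priorSupport ρ
  have hpair := nonempty_pair hd
  have halt : ∀ θ ∈ W, ∃ θ' ∈ W, RankNe θ θ' := fun θ _ => exists_rankNe hd hcompact θ
  obtain ⟨B, hB0, hB⟩ := hr.exists_log_bound
  obtain ⟨m, hm0, hm⟩ := hr.exists_maxMin_ge hsep halt hwStar
  have hl : 0 ≤ Real.log (Fintype.card (Pair d)) :=
    Real.log_nonneg (by exact_mod_cast Fintype.card_pos)
  set N : ℝ := (Fintype.card (Obs d) : ℝ) with hN
  have hN0 : 0 < N := by
    rw [hN]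
    exact_mod_cast Fintype.card_pos
  set C : ℝ := N * (2 * B) with hC
  have hC0 : 0 < C := by positivity
  -- `e` bounds both the loss of information and the effect of the deviations per comparison
  set e : ℝ := m * ε / (2 * (1 + ε)) with he_def
  have he0 : 0 < e := by positivity
  obtain ⟨r, hr0, hinfo⟩ := hr.exists_information_ge hsep halt hwStar he0
  obtain ⟨κ, hκ0, hκ⟩ := hr.exists_sum_klPair_ge hident hr0
  set s : ℝ := min 1 (κ / (2 * C)) with hs
  have hs0 : 0 < s := by positivity
  have hsκ : C * s < κ := by
    have : C * s ≤ C * (κ / (2 * C)) := by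
      gcongr
      exact min_le_right _ _
    have h2 : C * (κ / (2 * C)) = κ / 2 := by field_simp
    linarith
  set t : ℝ := min 1 (e / C) with ht
  have ht0 : 0 < t := by positivity
  have hte : C * t ≤ e := by
    have : C * t ≤ C * (e / C) := by
      gcongr
      exact min_le_right _ _
    rwa [mul_div_cancel₀ _ hC0.ne'] at this
  have hiv0 : ∀ θ, 0 ≤ invValue f W θ := fun θ =>
    Set.indicator_nonneg (fun θ hθ => inv_nonneg.2 (hm0.le.trans (hm θ hθ))) θ
  have hivM : ∀ θ, invValue f W θ ≤ m⁻¹ := fun θ => by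
    by_cases hθ : θ ∈ W
    · rw [invValue, Set.indicator_of_mem hθ]
      exact inv_anti₀ hm0 (hm θ hθ)
    · rw [invValue, Set.indicator_of_notMem hθ]
      positivity
  have hivm : Measurable (invValue f W) := measurable_indicator_of_continuousOn hr.isCompact
    ((hr.continuousOn_maxMin hsep halt hwStar).inv₀ fun θ hθ => (hm0.trans_le (hm θ hθ)).ne')
  refine ⟨r, hr0, 3 + (1 + ε) * (1 + N * 2) + N * 2 * (1 + 4 / t ^ 2),
    (1 + ε) * (N * 2 * (4 / s ^ 2)), by positivity, by positivity, ?_⟩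
  intro R c p Ω _ P Θ Y T he hR hp0 hp1 hexplore hadopt hT
  set v := ∫ θ, invValue f W θ * ρ θ with hv
  have hlint : ∫⁻ ω, ENNReal.ofReal (invValue f W (Θ ω)) ∂P = ENNReal.ofReal v :=
    he.lintegral_invValue hρ hivm hiv0 hivM
  have hv0 : 0 < v := by
    have h1 : ENNReal.ofReal (2 * B)⁻¹ ≤ ENNReal.ofReal v := by
      calc _ = ∫⁻ _ω, ENNReal.ofReal (2 * B)⁻¹ ∂P := by
            rw [lintegral_const, he.measure_univ hρ, mul_one]
        _ ≤ _ := lintegral_mono_ae ?_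
        _ = _ := hlint
      filter_upwards [he.ae_mem hρ] with ω hω
      refine ENNReal.ofReal_le_ofReal ?_
      rw [invValue, Set.indicator_of_mem hω]
      exact inv_anti₀ (hm0.trans_le (hm _ hω)) (hr.maxMin_le hB halt hwStar hω)
    exact ENNReal.ofReal_pos.1 (lt_of_lt_of_le (ENNReal.ofReal_pos.2 (by positivity)) h1)
  refine ⟨hv0, ?_⟩
  have hth : 0 ≤ threshold α c := by
    unfold threshold
    positivity
  set H := threshold α c + Real.log (Fintype.card (Pair d)) with hH
  have hH0 : 0 ≤ H := add_nonneg hth hl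
  set S : ℝ → Ω → Set ℕ := fun u ω => deviationTimes R (supportModel f W (Θ ω)) Y u ω with hS
  have hSm : ∀ u, Measurable fun ω => ((S u ω).encard : ℝ≥0∞) :=
    measurable_encard_deviationTimes he hr
  have hpath : ∀ᵐ ω ∂P, (T ω : ℝ≥0∞) ≤ 3 + ENNReal.ofReal (1 + ε) *
      (ENNReal.ofReal H * ENNReal.ofReal (invValue f W (Θ ω)) + (1 + (S (s * p) ω).encard)) +
        (S t ω).encard := by
    filter_upwards [he.ae_mem hρ, hexplore, hadopt] with ω hω hex had
    have hD := hm _ hω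
    have hD0 := hm0.trans_le hD
    set D := maxMin f W (Θ ω) with hDdef
    -- time `0` is exceptional: an estimate based on no observation carries no information
    have hb := stopping_bound (T := T ω) (F := insert 0 (S (s * p) ω)) (A := S t ω)
      (H := H * D⁻¹) (ε := ε) (by positivity) hε ?_
    · refine hb.trans ?_
      have h1 : ((insert 0 (S (s * p) ω)).encard : ℝ≥0∞) ≤ 1 + (S (s * p) ω).encard := by
        rw [add_comm]
        exact_mod_cast ENat.toENNReal_le.2 (Set.encard_insert_le (S (s * p) ω) 0)
      rw [invValue, Set.indicator_of_mem hω, ENNReal.ofReal_mul hH0]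
      gcongr
    · intro n hn hnA hle
      have hfω : supportModel f W (Θ ω) = f (Θ ω) := supportModel_eq hω
      simp only [hS, hfω] at hnA hle
      refine hT ω n hn (hr.le_glr hsep hcompact _ hω fun τ hτ hne => ?_)
      set F := insert 0 (deviationTimes R (f (Θ ω)) Y (s * p) ω)
      have hF : ∀ k ∉ F, D - e ≤ ∑ a, R k (history Y k ω) a * klPair f a (Θ ω) τ := by
        intro k hk
        obtain ⟨hk0, hkS⟩ := not_or.1 (mt Set.mem_insert_iff.2 hk)
        exact hinfo _ hω _ (hmle k _).1 (hr.dist_mle_lt hB hmle hκ R hp0 hex hsκ hω hk0 hkS) _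
          (hR _ _) (had k (by omega)) τ hτ hne
      have h1 := hr.le_logLik_sub_of_information hB hR hω hτ hF hnA
      refine le_trans ?_ h1
      set k : ℝ := ((F ∩ Set.Iio n).ncard : ℝ)
      have hk : 0 ≤ k := by positivity
      have hDe : D / (1 + ε) ≤ D - e - C * t := by
        have h2 : 2 * e = m * (ε / (1 + ε)) := by
          rw [he_def]
          field_simp
        have h3 : m * (ε / (1 + ε)) ≤ D * (ε / (1 + ε)) := by gcongr
        have h4 : D / (1 + ε) = D - D * (ε / (1 + ε)) := by
          field_simp
          ring
        linarith
      have h5 : D / (1 + ε) * ((1 + ε) * (H * D⁻¹ + k)) ≤ D / (1 + ε) * n := by gcongr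
      have h6 : D / (1 + ε) * ((1 + ε) * (H * D⁻¹ + k)) = H + D * k := by
        field_simp
      have h7 : D / (1 + ε) * n ≤ (D - e - C * t) * n := by gcongr
      have h8 : 0 ≤ e * k := by positivity
      have h9 : C * (t * n) = C * t * n := by ring
      rw [← hC, h9]
      linarith
  have hsp : s * p ≤ 1 := mul_le_one₀ (min_le_left _ _) hp0.le hp1
  have i1 := he.lintegral_encard_deviationTimes_le hρ hr hR (mul_pos hs0 hp0) hsp
  have i2 := he.lintegral_encard_deviationTimes_le hρ hr hR ht0 (min_le_left _ _)
  have m1 : Measurable fun ω => ENNReal.ofReal (invValue f W (Θ ω)) :=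
    (hivm.comp he.measurable_param).ennreal_ofReal
  have m2 : Measurable fun ω => 1 + ((S (s * p) ω).encard : ℝ≥0∞) :=
    measurable_const.add (hSm _)
  have m3 : Measurable fun ω => ENNReal.ofReal H * ENNReal.ofReal (invValue f W (Θ ω)) +
      (1 + ((S (s * p) ω).encard : ℝ≥0∞)) := (m1.const_mul _).add m2
  have aux : ∀ {q h v x y : ℝ}, 0 ≤ q → 0 ≤ h → 0 ≤ v → 0 ≤ x → 0 ≤ y →
      3 + ENNReal.ofReal q * (ENNReal.ofReal h * ENNReal.ofReal v + (1 + ENNReal.ofReal x)) +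
        ENNReal.ofReal y = ENNReal.ofReal (3 + q * (h * v + (1 + x)) + y) := by
    intro q h v x y hq hh hv hx hy
    rw [ENNReal.ofReal_add (by positivity) hy, ENNReal.ofReal_add (by positivity) (by positivity),
      ENNReal.ofReal_mul hq, ENNReal.ofReal_add (by positivity) (by positivity),
      ENNReal.ofReal_mul hh, ENNReal.ofReal_add zero_le_one hx, ENNReal.ofReal_one,
      ENNReal.ofReal_ofNat]
  calc expectedTime P T ≤ _ := lintegral_mono_ae hpath
    _ = 3 + ENNReal.ofReal (1 + ε) * (ENNReal.ofReal H * ENNReal.ofReal v +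
        (1 + ∫⁻ ω, (S (s * p) ω).encard ∂P)) + ∫⁻ ω, (S t ω).encard ∂P := by
      rw [lintegral_add_right _ (hSm t), lintegral_add_left measurable_const,
        lintegral_const_mul _ m3,
        lintegral_add_left (m1.const_mul _), lintegral_const_mul _ m1,
        lintegral_add_left measurable_const, hlint]
      simp [he.measure_univ hρ]
    _ ≤ 3 + ENNReal.ofReal (1 + ε) * (ENNReal.ofReal H * ENNReal.ofReal v +
        (1 + ENNReal.ofReal (N * 2 * (1 + 4 / (s * p) ^ 2)))) +
          ENNReal.ofReal (N * 2 * (1 + 4 / t ^ 2)) := by gcongr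
    _ = ENNReal.ofReal (3 + (1 + ε) * (H * v + (1 + N * 2 * (1 + 4 / (s * p) ^ 2))) +
          N * 2 * (1 + 4 / t ^ 2)) := by
      exact aux (by positivity) hH0 hv0.le (by positivity) (by positivity)
    _ = _ := by
      congr 1
      field_simp
      ring

/-- The asymptotic bound for every time that is reached once all generalized likelihood ratio
statistics exceed the threshold by `log |𝒜|`. -/
lemma limsup_expectedTime_le (hd : 1 ≤ d) {f : Param d → Pair d → Fin 2 → ℝ} {ρ : Param d → ℝ}
    {α : ℝ} (hα : 0 < α) (hρ : IsPriorDensity ρ) (hr : IsRegularModel f (priorSupport ρ))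
    (hcompact : CompactSupport (priorSupport ρ)) (hsep : Separated f (priorSupport ρ))
    (hident : Identifiable f (priorSupport ρ))
    {mle : (n : ℕ) → Hist d n → Param d} (hmle : IsMLE f (priorSupport ρ) mle)
    {wStar : Param d → Pair d → ℝ} (hwStar : IsOptimalDesign f (priorSupport ρ) wStar)
    {rule : ℝ → Rule d} (hrule : ∀ c, 0 < c → IsRule (rule c))
    {Ω : ℝ → Type*} [∀ c, MeasurableSpace (Ω c)] {P : ∀ c, Measure (Ω c)}
    {Θ : ∀ c, Ω c → Param d} {Y : ∀ c, ℕ → Ω c → Obs d}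
    (hexp : ∀ c, 0 < c → IsExperiment f ρ (rule c) (P c) (Θ c) (Y c))
    (hexplore : Explores rule P Y) (hadopt : AdoptsOptimal wStar mle rule P Y)
    {T : ∀ c, Ω c → ℕ∞}
    (hT : ∀ c ω (n : ℕ), 1 < n → (∀ p, threshold α c + Real.log (Fintype.card (Pair d)) ≤
      glr f (priorSupport ρ) (history (Y c) n ω) p) → T c ω ≤ n) :
    limsup (fun c => expectedTime (P c) (T c) / ENNReal.ofReal (expectedTc f ρ c))
      (𝓝[>] (0 : ℝ)) ≤ 1 := by
  obtain ⟨δ, hδ, hexplore⟩ := hexplore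
  refine ENNReal.le_of_forall_pos_le_add fun ε hε _ => ?_
  have hε2 : 0 < (ε : ℝ) / 2 := by positivity
  obtain ⟨r, hr0, a, b, ha, hb, hbound⟩ := exists_expectedTime_le (α := α) hd hρ hr hcompact hsep
    hident hmle hwStar hε2
  set v := ∫ θ, invValue f (priorSupport ρ) θ * ρ θ with hv
  set l := Real.log (Fintype.card (Pair d)) with hl
  have hlog : Tendsto (fun c : ℝ => |Real.log c|) (𝓝[>] 0) atTop :=
    tendsto_abs_atBot_atTop.comp Real.tendsto_log_nhdsGT_zero
  have hlim := (tendsto_ratio_bound hα hδ (1 + (ε : ℝ) / 2) l ((a + b) / v) (b / v)).comp hlog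
  refine limsup_le_of_le (by isBoundedDefault) ?_
  filter_upwards [hexplore, hadopt r hr0, self_mem_nhdsWithin, hlog.eventually_gt_atTop 0,
    hlim.eventually_le_const (show 1 + (ε : ℝ) / 2 < 1 + ε by linarith)] with c hex had hc hL hle
  set L := |Real.log c| with hLdef
  have hc0 : 0 < c := hc
  set p := L ^ (-(1 / 2 : ℝ) + δ) with hp
  have hp0 : 0 < p := Real.rpow_pos_of_pos hL _
  -- `p ≤ 1` can fail for large `δ`, so the exploration rate is truncated
  obtain ⟨hv0, hE⟩ := hbound (c := c) (p := min p 1) (hexp c hc0) (hrule c hc0) (by positivity)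
    (min_le_right _ _) (hex.mono fun ω h n a => (min_le_left _ _).trans (h n a)) had (hT c)
  have hLv : 0 < L * v := mul_pos hL hv0
  have hp2 : 1 / (min p 1) ^ 2 ≤ 1 + L * L ^ (-(2 * δ)) := by
    have h1 : L * L ^ (-(2 * δ)) = 1 / p ^ 2 := by
      rw [hp, ← Real.rpow_natCast, ← Real.rpow_mul hL.le, one_div, ← Real.rpow_neg hL.le]
      nth_rewrite 1 [← Real.rpow_one L]
      rw [← Real.rpow_add hL]
      congr 1
      push_cast
      ring
    rw [h1]
    rcases min_choice p 1 with h | h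
    · rw [h]
      linarith
    · rw [h]
      have : 0 < 1 / p ^ 2 := by positivity
      linarith
  rw [expectedTc_eq]
  refine ENNReal.div_le_of_le_mul (hE.trans ?_)
  have hε1 : (1 : ℝ≥0∞) + ε = ENNReal.ofReal (1 + (ε : ℝ)) := by
    rw [ENNReal.ofReal_add zero_le_one ε.coe_nonneg, ENNReal.ofReal_one, ENNReal.ofReal_coe_nnreal]
  rw [hε1, ← ENNReal.ofReal_mul (by positivity)]
  refine ENNReal.ofReal_le_ofReal ?_
  have h2 := mul_le_mul_of_nonneg_right hle hLv.le
  refine le_trans ?_ h2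
  have h3 : b / min p 1 ^ 2 ≤ b * (1 + L * L ^ (-(2 * δ))) := by
    rw [div_eq_mul_one_div]
    gcongr
  have h4 : ((1 + (ε : ℝ) / 2) * (1 + L ^ (-α) + l / L) +
      ((a + b) / v / L + b / v * L ^ (-(2 * δ)))) * (L * v) =
      (1 + (ε : ℝ) / 2) * ((L * (1 + L ^ (-α)) + l) * v) +
        (a + b * (1 + L * L ^ (-(2 * δ)))) := by
    field_simp
    ring
  simp only [Function.comp]
  rw [h4, threshold]
  linarith

end SeqRank

open SeqRank
theorem theorem3 {d : ℕ} (hd : 1 ≤ d)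
    (f : Param d → Pair d → Fin 2 → ℝ) (ρ : Param d → ℝ) (α : ℝ) (hα : 0 < α) (hα' : α < 1)
    (hρ : IsPriorDensity ρ)
    (hf : IsComparisonModel f (priorSupport ρ))
    (hcompact : CompactSupport (priorSupport ρ))
    (hregular : RegularSupport (priorSupport ρ))
    (hsmooth : SmoothLikelihood f (priorSupport ρ))
    (hsep : Separated f (priorSupport ρ))
    (hprior : PriorBounded ρ)
    (hident : Identifiable f (priorSupport ρ))
    (mle : (n : ℕ) → Hist d n → Param d) (hmle : IsMLE f (priorSupport ρ) mle)
    (wStar : Param d → Pair d → ℝ) (hwStar : IsOptimalDesign f (priorSupport ρ) wStar)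
    (rule : ℝ → Rule d) (hrule : ∀ c, 0 < c → IsRule (rule c))
    {Ω : ℝ → Type*} [∀ c, MeasurableSpace (Ω c)] (P : ∀ c, Measure (Ω c))
    (Θ : ∀ c, Ω c → Param d) (Y : ∀ c, ℕ → Ω c → Obs d)
    (hexp : ∀ c, 0 < c → IsExperiment f ρ (rule c) (P c) (Θ c) (Y c))
    (hexplore : Explores rule P Y)
    (hadopt : AdoptsOptimal wStar mle rule P Y) :
    limsup (fun c => expectedTime (P c) (stopTime₁ f (priorSupport ρ) α c (Y c)) /
        ENNReal.ofReal (expectedTc f ρ c)) (𝓝[>] (0 : ℝ)) ≤ 1 ∧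
    limsup (fun c => expectedTime (P c) (stopTime₂ f (priorSupport ρ) α c (Y c)) /
        ENNReal.ofReal (expectedTc f ρ c)) (𝓝[>] (0 : ℝ)) ≤ 1 := by
  have hr := IsRegularModel.of_smooth hcompact.1 hf hsmooth
  have hpair := nonempty_pair hd
  exact ⟨limsup_expectedTime_le hd hα hρ hr hcompact hsep hident hmle hwStar hrule hexp hexplore
      hadopt fun _ _ _ hn h => stopTime₁_le hn h,
    limsup_expectedTime_le hd hα hρ hr hcompact hsep hident hmle hwStar hrule hexp hexplore
      hadopt fun _ _ _ hn h => stopTime₂_le hn h⟩
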